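/- An \emph{arithmetic circuit} $C$ over $\mathbb{Q}$ in the variables $x_1,\dots,x_n$ is a topologically ordered list of gates, each of which is an input gate (a variable or a scalar from $\mathbb{Q}$) or a binary sum or product of earlier gates, with a distinguished output gate; $|C|$ is its total number of gates. It is \emph{skew} if one of the two operands of each multiplication gate is a variable or a scalar. Let $\varphi=\frac{1+\sqrt5}{2}$. Time is counted in the arithmetic model: on a random access machine, operations on machine words (used for control and addressing) and the operations $+,-,\times$ and tests for zero on rational numbers cost one step each. \textbf{Corollary.} There is a single deterministic algorithm with the following property. Let $g\in\mathbb{Q}[x_1,\dots,x_n]$ be homogeneous of degree $d$ with nonnegative coefficients, computed by a skew arithmetic circuit $C$. Given $C$ as input (the number $n$ of variables, the list of gates and the output gate, each rational scalar occupying one memory cell), the algorithm decides whether $g$ contains a square-free monomial of degree $d$ (a monomial $x_1^{a_1}\cdots x_n^{a_n}$ with all $a_i\in\{0,1\}$, $\sum_i a_i=d$, and nonzero coefficient in $g$), in at most $T=\varphi^{2d}\cdot|C|\cdot p(n)$ steps, where $p$ is a polynomial independent of $n$, $d$ and $C$, and with all machine words having $O(\log T)$ bits. -/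

import Mathlib

/-! ### Skew arithmetic circuits over `ℚ` -/

/-- A gate standing at position `k` of an arithmetic circuit in the variables `x_0, …, x_{n-1}`.
It is an input gate (a variable or a rational scalar) or a binary sum or product of gates at
earlier positions. -/
inductive Gate (n k : ℕ) : Type
  | var (i : Fin n) : Gate n k
  | scalar (c : ℚ) : Gate n k
  | add (a b : Fin k) : Gate n k
  | mul (a b : Fin k) : Gate n k

/-- An input gate: a variable or a scalar. -/
def Gate.IsInput {n k : ℕ} : Gate n k → Prop
  | .var _ => True
  | .scalar _ => True
  | .add _ _ => False
  | .mul _ _ => False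

/-- An arithmetic circuit over `ℚ` in `n` variables: an acyclic network of gates of fan-in two,
listed in a topological order, with a distinguished output gate. Input gates count towards the
size. -/
structure ArithCircuit (n : ℕ) : Type where
  size : ℕ
  gate : (k : Fin size) → Gate n k
  out : Fin size

namespace ArithCircuit

variable {n : ℕ}

/-- The polynomial computed at gate `k`. -/
noncomputable def gatePoly (C : ArithCircuit n) (k : ℕ) (hk : k < C.size) :
    MvPolynomial (Fin n) ℚ :=
  match C.gate ⟨k, hk⟩ with
  | .var i => MvPolynomial.X i
  | .scalar c => MvPolynomial.C c
  | .add a b => C.gatePoly a (a.isLt.trans hk) + C.gatePoly b (b.isLt.trans hk)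
  | .mul a b => C.gatePoly a (a.isLt.trans hk) * C.gatePoly b (b.isLt.trans hk)
termination_by k
decreasing_by all_goals exact Fin.isLt _

/-- The polynomial computed by the circuit. -/
noncomputable def poly (C : ArithCircuit n) : MvPolynomial (Fin n) ℚ :=
  C.gatePoly C.out C.out.isLt

/-- A circuit is skew if one of the two operands of each multiplication gate is a variable or a
scalar. -/
def IsSkew (C : ArithCircuit n) : Prop :=
  ∀ (k : Fin C.size) (a b : Fin k), C.gate k = .mul a b →
    (C.gate ⟨a, a.isLt.trans k.isLt⟩).IsInput ∨ (C.gate ⟨b, b.isLt.trans k.isLt⟩).IsInput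

end ArithCircuit

/-- The polynomial `g` contains (with nonzero coefficient) a square-free monomial of
degree `d`. -/
def HasSquareFreeMonomial {n : ℕ} (d : ℕ) (g : MvPolynomial (Fin n) ℚ) : Prop :=
  ∃ m : Fin n →₀ ℕ, g.coeff m ≠ 0 ∧ m.degree = d ∧ ∀ i, m i ≤ 1

/-! ### Random access machines with unit-cost rational arithmetic

The machine has registers and arrays of two sorts: *words*, which are natural numbers bounded by
a word bound `W` and serve for control and addressing, and *rationals*, on which it can only
perform ring operations and test for zero. A program is a fixed finite object, mentioning finitely
many registers and arrays. Rationals cannot be converted to words or rounded. -/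

namespace RAM

/-- A memory state. The first index of an array cell is the name of the array. -/
structure State : Type where
  wreg : ℕ → ℕ
  warr : ℕ → ℕ → ℕ
  qreg : ℕ → ℚ
  qarr : ℕ → ℕ → ℚ

/-- Word operations; subtraction is truncated, and division by zero returns zero. -/
inductive WOp : Type
  | add | sub | mul | div | mod

def WOp.eval : WOp → ℕ → ℕ → ℕ
  | .add, x, y => x + y
  | .sub, x, y => x - y
  | .mul, x, y => x * y
  | .div, x, y => x / y
  | .mod, x, y => x % y

/-- Rational operations. -/
inductive QOp : Type
  | add | sub | mul

def QOp.eval : QOp → ℚ → ℚ → ℚ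
  | .add, x, y => x + y
  | .sub, x, y => x - y
  | .mul, x, y => x * y

/-- Elementary instructions. In order: `w_r := c`, `w_r := w_a ∘ w_b`, `w_r := A[w_i]`,
`A[w_i] := w_a` for words, and the same four for rationals (addresses are always words). -/
inductive Instr : Type
  | wconst (r c : ℕ)
  | wop (o : WOp) (r a b : ℕ)
  | wload (r A i : ℕ)
  | wstore (A i a : ℕ)
  | qconst (r : ℕ) (c : ℚ)
  | qop (o : QOp) (r a b : ℕ)
  | qload (r A i : ℕ)
  | qstore (A i a : ℕ)

def State.setW (s : State) (r v : ℕ) : State :=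
  { s with wreg := Function.update s.wreg r v }

def State.setQ (s : State) (r : ℕ) (v : ℚ) : State :=
  { s with qreg := Function.update s.qreg r v }

def State.setWArr (s : State) (A i v : ℕ) : State :=
  { s with warr := Function.update s.warr A (Function.update (s.warr A) i v) }

def State.setQArr (s : State) (A i : ℕ) (v : ℚ) : State :=
  { s with qarr := Function.update s.qarr A (Function.update (s.qarr A) i v) }

/-- The effect of an elementary instruction. -/
def Instr.run : Instr → State → State
  | .wconst r c, s => s.setW r c
  | .wop o r a b, s => s.setW r (o.eval (s.wreg a) (s.wreg b))
  | .wload r A i, s => s.setW r (s.warr A (s.wreg i))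
  | .wstore A i a, s => s.setWArr A (s.wreg i) (s.wreg a)
  | .qconst r c, s => s.setQ r c
  | .qop o r a b, s => s.setQ r (o.eval (s.qreg a) (s.qreg b))
  | .qload r A i, s => s.setQ r (s.qarr A (s.wreg i))
  | .qstore A i a, s => s.setQArr A (s.wreg i) (s.qreg a)

/-- The instruction does not overflow: it writes and uses only words that are at most `W`. -/
def Instr.Fits (W : ℕ) : Instr → State → Prop
  | .wconst _ c, _ => c ≤ W
  | .wop o _ a b, s =>
      s.wreg a ≤ W ∧ s.wreg b ≤ W ∧ o.eval (s.wreg a) (s.wreg b) ≤ W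
  | .wload _ A i, s => s.wreg i ≤ W ∧ s.warr A (s.wreg i) ≤ W
  | .wstore _ i a, s => s.wreg i ≤ W ∧ s.wreg a ≤ W
  | .qconst _ _, _ => True
  | .qop _ _ _ _, _ => True
  | .qload _ _ i, s => s.wreg i ≤ W
  | .qstore _ i _, s => s.wreg i ≤ W

/-- Tests: `w_a < w_b`, `w_a = w_b`, and `q_a = 0`. -/
inductive Test : Type
  | wlt (a b : ℕ)
  | weq (a b : ℕ)
  | qzero (a : ℕ)

def Test.Holds : Test → State → Prop
  | .wlt a b, s => s.wreg a < s.wreg b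
  | .weq a b, s => s.wreg a = s.wreg b
  | .qzero a, s => s.qreg a = 0

/-- Programs. -/
inductive Prog : Type
  | skip
  | instr (i : Instr)
  | seq (P Q : Prog)
  | ite (b : Test) (P Q : Prog)
  | loop (b : Test) (P : Prog)

/-- `Exec W P s t s'`: with word bound `W`, the program `P` started in state `s` halts after `t`
steps in state `s'` without overflow. Every elementary instruction and every test takes one
step; `loop b P` is "while `b` do `P`". -/
inductive Exec (W : ℕ) : Prog → State → ℕ → State → Prop
  | skip (s : State) : Exec W .skip s 1 s
  | instr (i : Instr) (s : State) (h : i.Fits W s) : Exec W (.instr i) s 1 (i.run s)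
  | seq {P Q : Prog} {s₁ s₂ s₃ : State} {t₁ t₂ : ℕ}
      (h₁ : Exec W P s₁ t₁ s₂) (h₂ : Exec W Q s₂ t₂ s₃) : Exec W (.seq P Q) s₁ (t₁ + t₂) s₃
  | iteTrue {b : Test} {P Q : Prog} {s s' : State} {t : ℕ}
      (hb : b.Holds s) (h : Exec W P s t s') : Exec W (.ite b P Q) s (t + 1) s'
  | iteFalse {b : Test} {P Q : Prog} {s s' : State} {t : ℕ}
      (hb : ¬ b.Holds s) (h : Exec W Q s t s') : Exec W (.ite b P Q) s (t + 1) s'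
  | loopDone {b : Test} {P : Prog} {s : State}
      (hb : ¬ b.Holds s) : Exec W (.loop b P) s 1 s
  | loopStep {b : Test} {P : Prog} {s₁ s₂ s₃ : State} {t₁ t₂ : ℕ}
      (hb : b.Holds s₁) (h₁ : Exec W P s₁ t₁ s₂) (h₂ : Exec W (.loop b P) s₂ t₂ s₃) :
      Exec W (.loop b P) s₁ (t₁ + t₂ + 1) s₃

end RAM

/-! ### Circuits as inputs of a machine -/

/-- The three words describing a gate: its kind, and its operands. -/
def Gate.code {n k : ℕ} : Gate n k → ℕ × ℕ × ℕ
  | .var i => (0, i, 0)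
  | .scalar _ => (1, 0, 0)
  | .add a b => (2, a, b)
  | .mul a b => (3, a, b)

/-- The scalar stored with a gate (zero unless it is a scalar gate). -/
def Gate.scalarPart {n k : ℕ} : Gate n k → ℚ
  | .scalar c => c
  | .var _ => 0
  | .add _ _ => 0
  | .mul _ _ => 0

/-- The initial memory when the circuit `C` in `n` variables is the input: the word registers
`0, 1, 2` hold `n`, the number of gates, and the position of the output gate; entry `k` of the word
arrays `0, 1, 2` and of the rational array `0` describes gate `k`; everything else is zero. -/
def ArithCircuit.input {n : ℕ} (C : ArithCircuit n) : RAM.State where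
  wreg r := if r = 0 then n else if r = 1 then C.size else if r = 2 then (C.out : ℕ) else 0
  warr A k :=
    if h : k < C.size then
      if A = 0 then (C.gate ⟨k, h⟩).code.1
      else if A = 1 then (C.gate ⟨k, h⟩).code.2.1
      else if A = 2 then (C.gate ⟨k, h⟩).code.2.2
      else 0
    else 0
  qreg _ := 0
  qarr A k := if h : k < C.size then if A = 0 then (C.gate ⟨k, h⟩).scalarPart else 0 else 0

/-! In the exterior algebra of `ℚ[X]`, the operator `apolarOp α` contracts with the evaluation at α
and then multiplies every factor by X - α. Evaluating (X - α)p at β gives (β - α)p(β), so the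
product of the operators of α and β is β - α times an operator that changes sign when α and β are
exchanged. Hence these operators commute and have square zero (`apolarOp_comm`, `apolarOp_sq`), and
sending x_i to `apolarOp i` extends to an algebra homomorphism Ψ that kills every monomial that is
not square-free.

Applied to q ∧ qX ∧ ⋯ ∧ qX^(d-1), `apolarOp α` gives q(α) times the wedge of the same shape for q(X
- α)² with one factor fewer (`apolarOp_powerWedge_succ`). Starting from q = 1, d distinct operators
therefore give a product of squares of nonzero differences, a positive scalar. So Ψ(g) maps 1 ∧ X ∧
⋯ ∧ X^(d-1) to a combination, with positive weights, of the coefficients of g at square-free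
monomials. Nonnegative coefficients cannot cancel, so this scalar is nonzero exactly when such a
monomial occurs (`apolarEval_apply_powerWedge`).

In a skew circuit a product gate applies a scalar or a single `apolarOp` to a vector that is already
known, so it suffices to compute one vector per gate.

The golden ratio comes from the sparsity of these vectors. Let the wedge of the X^j with j in J have
size |J| + max J + 1, the empty wedge having size 0. The start vector has size 2d. A contraction
lowers the size by at least one, and the multiplication by X - α raises the largest exponent by at
most one, so all sizes stay at most 2d. In binary, from the lowest digit, a one costs two units and
a zero one unit, so there are F(2d+1) ≤ φ^(2d) masks of such size (`length_maskList`,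
`fib_succ_le_goldenRatio_pow`). The multiplication by X - α is made one position at a time, each
replacement sending a mask to at most two masks; an operator thus takes O(d F(2d+1)) steps, plus
O(n) steps to produce α (`wedgeOf_apolarCoord`, `apolarProg_spec`).

The degree is not part of the input. It is read off from g(2,…,2) = 2^d g(1,…,1). If g(1,…,1) = 0,
then g = 0 by nonnegativity; if d > n, there is no square-free monomial of degree d. Otherwise d ≤
n, and the factors d are absorbed in p(n). -/

/-! ### Wedge products indexed by bit masks, and the operators `apolarOp α` -/

section Wedge

variable {V : Type*} [AddCommGroup V] [Module ℚ V]

/-- The wedge product of the vectors `b i`, where `i` runs over the bits of `J` in increasing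
order. -/
def maskWedge (b : ℕ → V) (J : ℕ) : ExteriorAlgebra ℚ V :=
  if _h : J = 0 then 1
  else if J % 2 = 1 then ExteriorAlgebra.ι ℚ (b 0) * maskWedge (fun i => b (i + 1)) (J / 2)
  else maskWedge (fun i => b (i + 1)) (J / 2)
termination_by J
decreasing_by all_goals omega

@[simp] theorem maskWedge_zero (b : ℕ → V) : maskWedge b 0 = 1 := by
  rw [maskWedge]; simp

theorem maskWedge_odd (b : ℕ → V) (m : ℕ) :
    maskWedge b (2 * m + 1) = ExteriorAlgebra.ι ℚ (b 0) * maskWedge (fun i => b (i + 1)) m := by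
  rw [maskWedge, dif_neg (by omega), if_pos (by omega)]
  congr 2; omega

theorem maskWedge_even (b : ℕ → V) (m : ℕ) :
    maskWedge b (2 * m) = maskWedge (fun i => b (i + 1)) m := by
  rcases Nat.eq_zero_or_pos m with rfl | hm
  · simp
  · rw [maskWedge, dif_neg (by omega), if_neg (by omega)]
    congr 1; omega

theorem Nat.evenOdd_cases (J : ℕ) : ∃ m, J = 2 * m ∨ J = 2 * m + 1 := ⟨J / 2, by omega⟩

theorem Nat.testBit_even_succ (m j : ℕ) : (2 * m).testBit (j + 1) = m.testBit j := by
  rw [Nat.testBit_succ]; congr 1; omega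

theorem Nat.testBit_odd_succ (m j : ℕ) : (2 * m + 1).testBit (j + 1) = m.testBit j := by
  rw [Nat.testBit_succ]; congr 1; omega

theorem Nat.testBit_even_zero (m : ℕ) : (2 * m).testBit 0 = false := by
  simp

theorem Nat.testBit_odd_zero (m : ℕ) : (2 * m + 1).testBit 0 = true := by
  simp

theorem Nat.two_pow_le_of_testBit {J j : ℕ} (h : J.testBit j = true) : 2 ^ j ≤ J :=
  Nat.ge_two_pow_of_testBit h

theorem maskWedge_map {V' : Type*} [AddCommGroup V'] [Module ℚ V'] (f : V →ₗ[ℚ] V') (b : ℕ → V)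
    (J : ℕ) : ExteriorAlgebra.map f (maskWedge b J) = maskWedge (fun i => f (b i)) J := by
  induction J using Nat.strong_induction_on generalizing b with
  | _ J ih =>
    obtain ⟨m, rfl | rfl⟩ := Nat.evenOdd_cases J
    · rcases Nat.eq_zero_or_pos m with rfl | hm
      · simp
      · rw [maskWedge_even, maskWedge_even, ih m (by omega)]
    · rw [maskWedge_odd, maskWedge_odd, map_mul, ExteriorAlgebra.map_apply_ι, ih m (by omega)]

theorem maskWedge_congr {b b' : ℕ → V} {J : ℕ} (h : ∀ i, J.testBit i = true → b i = b' i) :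
    maskWedge b J = maskWedge b' J := by
  induction J using Nat.strong_induction_on generalizing b b' with
  | _ J ih =>
    obtain ⟨m, rfl | rfl⟩ := Nat.evenOdd_cases J
    · rcases Nat.eq_zero_or_pos m with rfl | hm
      · simp
      · rw [maskWedge_even, maskWedge_even]
        exact ih m (by omega) fun i hi => h (i + 1) (by rwa [Nat.testBit_even_succ])
    · rw [maskWedge_odd, maskWedge_odd, h 0 (by simp)]
      congr 1
      exact ih m (by omega) fun i hi => h (i + 1) (by rwa [Nat.testBit_odd_succ])

theorem algebraMapInv_maskWedge (b : ℕ → V) (J : ℕ) (hJ : J ≠ 0) :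
    ExteriorAlgebra.algebraMapInv (maskWedge b J) = 0 := by
  induction J using Nat.strong_induction_on generalizing b with
  | _ J ih =>
    obtain ⟨m, rfl | rfl⟩ := Nat.evenOdd_cases J
    · rw [maskWedge_even]; exact ih m (by omega) _ (by omega)
    · rw [maskWedge_odd, map_mul]; simp [ExteriorAlgebra.algebraMapInv]

/-- Replacing `b j` by `b (j + 1) + c • b j` in a wedge product. -/
theorem maskWedge_replace (j : ℕ) (c : ℚ) {b b' : ℕ → V} (hne : ∀ i, i ≠ j → b' i = b i)
    (hj : b' j = b (j + 1) + c • b j) (J : ℕ) :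
    maskWedge b' J = if J.testBit j = true then
      (if J.testBit (j + 1) = true then 0 else maskWedge b (J + 2 ^ j)) + c • maskWedge b J
      else maskWedge b J := by
  induction j generalizing b b' J with
  | zero =>
    obtain ⟨m, rfl | rfl⟩ := Nat.evenOdd_cases J
    · rw [Nat.testBit_even_zero, if_neg (by simp)]
      refine maskWedge_congr fun i hi => hne i ?_
      rintro rfl
      simp at hi
    · have hs : (fun i => b' (i + 1)) = fun i => b (i + 1) := funext fun i => hne _ (by omega)
      rw [Nat.testBit_odd_zero, if_pos rfl, Nat.testBit_odd_succ, maskWedge_odd, maskWedge_odd, hj,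
        hs, map_add, map_smul, add_mul, smul_mul_assoc]
      congr 1
      obtain ⟨q, rfl | rfl⟩ := Nat.evenOdd_cases m
      -- The factors at positions j and j + 1 are adjacent, so the bit moves up without a sign. If
      -- bit j + 1 is already set, a vector is repeated and the wedge vanishes.
      · rw [Nat.testBit_even_zero, if_neg (by simp), maskWedge_even,
          show 2 * (2 * q) + 1 + 2 ^ (0 : ℕ) = 2 * (2 * q + 1) by ring, maskWedge_even,
          maskWedge_odd]
      · rw [Nat.testBit_odd_zero, if_pos rfl, maskWedge_odd, ← mul_assoc,
          ExteriorAlgebra.ι_sq_zero, zero_mul]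
  | succ j ih =>
    obtain ⟨m, rfl | rfl⟩ := Nat.evenOdd_cases J
    · rw [maskWedge_even, maskWedge_even, Nat.testBit_even_succ, Nat.testBit_even_succ,
        show 2 * m + 2 ^ (j + 1) = 2 * (m + 2 ^ j) by ring, maskWedge_even]
      exact ih (fun i hi => hne _ (by omega)) hj m
    · rw [maskWedge_odd, maskWedge_odd, Nat.testBit_odd_succ, Nat.testBit_odd_succ,
        show 2 * m + 1 + 2 ^ (j + 1) = 2 * (m + 2 ^ j) + 1 by ring, maskWedge_odd,
        hne 0 (by omega), ih (b := fun i => b (i + 1)) (fun i hi => hne _ (by omega)) hj m]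
      split_ifs <;> simp [mul_add]

/-- The parity sign of the number of bits of `J` below position `j`. -/
def maskSign (J : ℕ) : ℕ → ℚ
  | 0 => 1
  | j + 1 => if J.testBit j = true then -maskSign J j else maskSign J j

theorem maskSign_even (m j : ℕ) : maskSign (2 * m) (j + 1) = maskSign m j := by
  induction j with
  | zero => simp [maskSign]
  | succ j ih => rw [maskSign, ih, Nat.testBit_even_succ, maskSign]

theorem maskSign_odd (m j : ℕ) : maskSign (2 * m + 1) (j + 1) = -maskSign m j := by
  induction j with
  | zero => simp [maskSign]
  | succ j ih =>
    rw [maskSign, ih, Nat.testBit_odd_succ, maskSign]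
    split_ifs <;> simp

-- Contraction is an antiderivation: the factor at j is reached after passing the factors at lower
-- positions, whence the sign. The bound `2 ^ N` only makes the range contain all bits of `J`.
open CliffordAlgebra in
theorem contractLeft_maskWedge (f : Module.Dual ℚ V) (N : ℕ) (b : ℕ → V) (J : ℕ)
    (hJ : J < 2 ^ N) :
    contractLeft (Q := (0 : QuadraticForm ℚ V)) f (maskWedge b J) =
      ∑ j ∈ Finset.range N, if J.testBit j = true then
        (maskSign J j * f (b j)) • maskWedge b (J - 2 ^ j) else 0 := by
  induction N generalizing b J with
  | zero =>
    obtain rfl : J = 0 := by simpa using hJ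
    simp
  | succ N ih =>
    rw [Finset.sum_range_succ']
    obtain ⟨m, rfl | rfl⟩ := Nat.evenOdd_cases J
    · rw [maskWedge_even, ih _ m (by omega), Nat.testBit_even_zero]
      simp only [Bool.false_eq_true, if_false, add_zero]
      refine Finset.sum_congr rfl fun j _ => ?_
      rw [Nat.testBit_even_succ, maskSign_even,
        show 2 * m - 2 ^ (j + 1) = 2 * (m - 2 ^ j) by rw [pow_succ]; omega, maskWedge_even]
    · rw [maskWedge_odd, Nat.testBit_odd_zero, if_pos rfl]
      rw [show ExteriorAlgebra.ι ℚ (b 0) = ι (0 : QuadraticForm ℚ V) (b 0) from rfl,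
        contractLeft_ι_mul, ih _ m (by omega), Finset.mul_sum, sub_eq_add_neg,
        ← Finset.sum_neg_distrib, add_comm]
      congr 1
      · refine Finset.sum_congr rfl fun j _ => ?_
        rw [Nat.testBit_odd_succ, maskSign_odd]
        split_ifs with h
        · have := Nat.two_pow_le_of_testBit h
          rw [show 2 * m + 1 - 2 ^ (j + 1) = 2 * (m - 2 ^ j) + 1 by rw [pow_succ]; omega,
            maskWedge_odd]
          simp only [mul_smul_comm, neg_mul, neg_smul]
        · simp
      · rw [show 2 * m + 1 - 2 ^ 0 = 2 * m by simp, maskWedge_even]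
        simp [maskSign]

end Wedge

/-! ### Commuting square-zero operators on the exterior algebra of the polynomials -/

section ApolarOp

open Polynomial CliffordAlgebra

/-- The exterior algebra of the polynomials in one variable. -/
abbrev PolyWedge : Type := ExteriorAlgebra ℚ ℚ[X]

/-- Contraction by the evaluation at `α`. -/
noncomputable def evalContract (α : ℚ) : Module.End ℚ PolyWedge :=
  contractLeft (Q := (0 : QuadraticForm ℚ ℚ[X])) (Polynomial.leval α)

/-- Contraction by the evaluation at `α`, followed by the exterior power of the multiplication
by `X - α`. -/
noncomputable def apolarOp (α : ℚ) : Module.End ℚ PolyWedge :=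
  (ExteriorAlgebra.map (LinearMap.mulLeft ℚ (X - C α))).toLinearMap ∘ₗ evalContract α

/-- The contracting functional is pulled back along f. Both sides obey the same antiderivation rule,
so induction over left multiplication by vectors applies. -/
theorem contractLeft_map (f : ℚ[X] →ₗ[ℚ] ℚ[X]) (l : Module.Dual ℚ ℚ[X]) (x : PolyWedge) :
    contractLeft (Q := (0 : QuadraticForm ℚ ℚ[X])) l (ExteriorAlgebra.map f x) =
      ExteriorAlgebra.map f (contractLeft (Q := (0 : QuadraticForm ℚ ℚ[X])) (l ∘ₗ f) x) := by
  induction x using CliffordAlgebra.left_induction with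
  | algebraMap r =>
    rw [AlgHom.commutes, contractLeft_algebraMap, contractLeft_algebraMap, map_zero]
  | add x y hx hy => simp only [map_add, hx, hy]
  | ι_mul x v hx =>
    have h : ExteriorAlgebra.map f (ι (0 : QuadraticForm ℚ ℚ[X]) v) =
      ι (0 : QuadraticForm ℚ ℚ[X]) (f v) := ExteriorAlgebra.map_apply_ι f v
    rw [map_mul, h, contractLeft_ι_mul, contractLeft_ι_mul, hx, map_sub, map_smul, map_mul, h]
    rfl

/-- Contraction by the evaluation at β is moved past the multiplication by X - α, which turns this
evaluation into β - α times itself. Commutativity and nilpotence can be read off from this form. -/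
theorem apolarOp_apolarOp (α β : ℚ) (x : PolyWedge) :
    apolarOp β (apolarOp α x) = (β - α) •
      ExteriorAlgebra.map (LinearMap.mulLeft ℚ ((X - C β) * (X - C α)))
        (evalContract β (evalContract α x)) := by
  have h : Polynomial.leval β ∘ₗ LinearMap.mulLeft ℚ (X - C α) = (β - α) • Polynomial.leval β := by
    ext n; simp
  simp only [apolarOp, LinearMap.comp_apply, AlgHom.toLinearMap_apply]
  rw [evalContract, contractLeft_map, h, map_smul, LinearMap.smul_apply, map_smul, map_smul,
    ← AlgHom.comp_apply, ExteriorAlgebra.map_comp_map, ← LinearMap.mulLeft_mul]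

/-- Exchanging α and β changes the sign of the scalar β - α and that of the two anticommuting
contractions; the two signs cancel. -/
theorem apolarOp_comm (α β : ℚ) : apolarOp β * apolarOp α = apolarOp α * apolarOp β := by
  refine LinearMap.ext fun x => ?_
  rw [Module.End.mul_apply, Module.End.mul_apply, apolarOp_apolarOp, apolarOp_apolarOp]
  rw [show evalContract β (evalContract α x) = -evalContract α (evalContract β x) from
    contractLeft_comm _ _ _, map_neg, smul_neg, ← neg_smul, neg_sub, mul_comm (X - C β)]

theorem apolarOp_sq (α : ℚ) : apolarOp α * apolarOp α = 0 := by
  refine LinearMap.ext fun x => ?_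
  rw [Module.End.mul_apply, apolarOp_apolarOp, sub_self, zero_smul, LinearMap.zero_apply]

/-- The wedge product `q ∧ q X ∧ ⋯ ∧ q X ^ (d - 1)`. -/
noncomputable def powerWedge (q : ℚ[X]) (d : ℕ) : PolyWedge := maskWedge (fun i => q * X ^ i) (2 ^ d - 1)

theorem maskWedge_all_ones_succ {V : Type*} [AddCommGroup V] [Module ℚ V] (b : ℕ → V) (d : ℕ) :
    maskWedge b (2 ^ (d + 1) - 1) =
      ExteriorAlgebra.ι ℚ (b 0) * maskWedge (fun i => b (i + 1)) (2 ^ d - 1) := by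
  have := Nat.one_le_two_pow (n := d)
  rw [show 2 ^ (d + 1) - 1 = 2 * (2 ^ d - 1) + 1 by rw [pow_succ]; omega, maskWedge_odd]

/-- Each added term is a multiple of the preceding factor and is absorbed by it. The extra factor `b
0` in front absorbs the first one. -/
theorem ι_mul_maskWedge_shear {V : Type*} [AddCommGroup V] [Module ℚ V] (c : ℚ) (b : ℕ → V)
    (d : ℕ) : ExteriorAlgebra.ι ℚ (b 0) * maskWedge (fun i => b (i + 1) + c • b i) (2 ^ d - 1) =
      ExteriorAlgebra.ι ℚ (b 0) * maskWedge (fun i => b (i + 1)) (2 ^ d - 1) := by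
  induction d generalizing b with
  | zero => simp
  | succ d ih =>
    rw [maskWedge_all_ones_succ, maskWedge_all_ones_succ, map_add, map_smul, add_mul, mul_add,
      ih (fun i => b (i + 1))]
    simp only [smul_mul_assoc, mul_smul_comm]
    rw [← mul_assoc (ExteriorAlgebra.ι ℚ (b 0)) (ExteriorAlgebra.ι ℚ (b 0)),
      ExteriorAlgebra.ι_sq_zero, zero_mul, smul_zero, add_zero]

theorem contractLeft_maskWedge_eq_zero {V : Type*} [AddCommGroup V] [Module ℚ V]
    (f : Module.Dual ℚ V) (b : ℕ → V) (J : ℕ) (h : ∀ i, f (b i) = 0) :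
    contractLeft (Q := (0 : QuadraticForm ℚ V)) f (maskWedge b J) = 0 := by
  rw [contractLeft_maskWedge f J b J Nat.lt_two_pow_self]
  exact Finset.sum_eq_zero fun j _ => by simp [h]

/-- By the shear, all factors but the first may be taken divisible by X - α. They vanish at α, so
the contraction only removes the first factor. The subsequent multiplication provides the second
power of X - α. -/
theorem apolarOp_powerWedge_succ (α : ℚ) (q : ℚ[X]) (d : ℕ) :
    apolarOp α (powerWedge q (d + 1)) = q.eval α • powerWedge (q * (X - C α) ^ 2) d := by
  have h1 : powerWedge q (d + 1) = ExteriorAlgebra.ι ℚ q *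
      maskWedge (fun i => q * (X - C α) * X ^ i) (2 ^ d - 1) := by
    have := ι_mul_maskWedge_shear (-α) (fun i => q * X ^ i) d
    simp only [pow_zero, mul_one] at this
    rw [powerWedge, maskWedge_all_ones_succ, pow_zero, mul_one, ← this]
    congr 2
    funext i
    rw [Polynomial.smul_eq_C_mul, C_neg]; ring
  rw [h1, apolarOp, LinearMap.comp_apply, evalContract]
  rw [show ExteriorAlgebra.ι ℚ q = ι (0 : QuadraticForm ℚ ℚ[X]) q from rfl]
  rw [contractLeft_ι_mul, contractLeft_maskWedge_eq_zero _ _ _ (by intro i; simp), mul_zero,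
    sub_zero, map_smul, AlgHom.toLinearMap_apply, maskWedge_map, powerWedge]
  congr 2
  funext i
  simp only [LinearMap.mulLeft_apply]; ring

/-- Applying pairwise distinct operators to `q ∧ q X ∧ ⋯ ∧ q X ^ (d - 1)` gives a positive
scalar, if `q` is positive at their points. -/
theorem exists_pos_prod_apolarOp (l : List ℚ) (hl : l.Nodup) (q : ℚ[X])
    (hq : ∀ α ∈ l, 0 < q.eval α) :
    ∃ r : ℚ, 0 < r ∧ ((l.map apolarOp).reverse).prod (powerWedge q l.length) =
      algebraMap ℚ PolyWedge r := by
  induction l generalizing q with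
  | nil => exact ⟨1, one_pos, by simp [powerWedge]⟩
  | cons α l ih =>
    obtain ⟨hα, hl⟩ := List.nodup_cons.1 hl
    -- The new weight stays positive at the remaining points because they differ from α and the new
    -- factor is a square.
    obtain ⟨r, hr, h⟩ := ih hl (q * (X - C α) ^ 2) fun β hβ => by
      have hne : β - α ≠ 0 := sub_ne_zero.2 fun h => hα (h ▸ hβ)
      have := hq β (List.mem_cons_of_mem _ hβ)
      simp only [eval_mul, eval_pow, eval_sub, eval_X, eval_C]
      positivity
    have h0 := hq α List.mem_cons_self
    refine ⟨q.eval α * r, mul_pos h0 hr, ?_⟩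
    rw [List.map_cons, List.reverse_cons, List.prod_append, List.prod_singleton, List.length_cons,
      Module.End.mul_apply, apolarOp_powerWedge_succ, map_smul, h, map_mul, ← Algebra.smul_def]

end ApolarOp

/-! ### Evaluation of a polynomial at the operators detects square-free monomials -/

section ApolarEval

open MvPolynomial

-- The ring `A` need not be commutative, but the subalgebra generated by commuting elements is;
-- evaluation takes place there.
open scoped IsMulCommutative in
theorem exists_algHom_of_commute {n : ℕ} {A : Type*} [Ring A] [Algebra ℚ A] (f : Fin n → A)
    (hf : ∀ i j, f i * f j = f j * f i) :
    ∃ Ψ : MvPolynomial (Fin n) ℚ →ₐ[ℚ] A, ∀ i, Ψ (X i) = f i := by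
  have := Algebra.isMulCommutative_adjoin ℚ (s := Set.range f) (by
    rintro _ ⟨i, rfl⟩ _ ⟨j, rfl⟩
    exact hf i j)
  let φ : MvPolynomial (Fin n) ℚ →ₐ[ℚ] Algebra.adjoin ℚ (Set.range f) :=
    aeval fun i => ⟨f i, Algebra.subset_adjoin ⟨i, rfl⟩⟩
  refine ⟨(Algebra.adjoin ℚ (Set.range f)).val.comp φ, fun i => ?_⟩
  simp [φ]

theorem exists_apolarEval (n : ℕ) :
    ∃ Ψ : MvPolynomial (Fin n) ℚ →ₐ[ℚ] Module.End ℚ PolyWedge,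
      ∀ i, Ψ (X i) = apolarOp ((i : ℕ) : ℚ) :=
  exists_algHom_of_commute _ fun _ _ => apolarOp_comm _ _

theorem apolarEval_monomial_not_squareFree {n : ℕ}
    {Ψ : MvPolynomial (Fin n) ℚ →ₐ[ℚ] Module.End ℚ PolyWedge}
    (hΨ : ∀ i, Ψ (X i) = apolarOp ((i : ℕ) : ℚ)) (m : Fin n →₀ ℕ) (c : ℚ) (h : ¬ ∀ i, m i ≤ 1) :
    Ψ (monomial m c) = 0 := by
  push Not at h
  obtain ⟨i, hi⟩ := h
  have : monomial m c = X i * X i * monomial (m - Finsupp.single i 2) c := by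
    rw [← pow_two, X_pow_eq_monomial, monomial_mul, one_mul, add_tsub_cancel_of_le]
    simpa using Nat.succ_le_of_lt hi
  rw [this, map_mul, map_mul, hΨ, apolarOp_sq, zero_mul]

theorem apolarEval_monomial_squareFree {n : ℕ}
    {Ψ : MvPolynomial (Fin n) ℚ →ₐ[ℚ] Module.End ℚ PolyWedge}
    (hΨ : ∀ i, Ψ (X i) = apolarOp ((i : ℕ) : ℚ)) (m : Fin n →₀ ℕ) (h : ∀ i, m i ≤ 1) :
    ∃ r : ℚ, 0 < r ∧ ∀ c, Ψ (monomial m c) (powerWedge 1 m.degree) =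
      algebraMap ℚ PolyWedge (c * r) := by
  -- The list is reversed to match `exists_pos_prod_apolarOp`, where the head of the list acts
  -- first.
  have hp : ∀ c, monomial m c = C c * (m.support.toList.reverse.map fun i => (X i : MvPolynomial (Fin n) ℚ)).prod := by
    intro c
    rw [(List.Perm.map _ (List.reverse_perm _)).prod_eq, Finset.prod_map_toList, monomial_eq,
      Finsupp.prod]
    congr 1
    refine Finset.prod_congr rfl fun i hi => ?_
    have := Finsupp.mem_support_iff.1 hi
    rw [show m i = 1 by have := h i; omega, pow_one]
  have hd : m.degree = (m.support.toList.map fun (i : Fin n) => ((i : ℕ) : ℚ)).length := by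
    rw [List.length_map, Finset.length_toList, Finsupp.degree_apply, Finset.card_eq_sum_ones]
    refine Finset.sum_congr rfl fun i hi => ?_
    have := Finsupp.mem_support_iff.1 hi
    have := h i
    omega
  obtain ⟨r, hr, hP⟩ := exists_pos_prod_apolarOp (m.support.toList.map fun (i : Fin n) => ((i : ℕ) : ℚ))
    (m.support.nodup_toList.map fun i j hij => Fin.ext (by exact_mod_cast hij)) 1 (by simp)
  refine ⟨r, hr, fun c => ?_⟩
  rw [hp, map_mul, ← algebraMap_eq, AlgHom.commutes, Module.End.mul_apply,
    Module.algebraMap_end_apply, map_list_prod, List.map_map,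
    map_mul, ← Algebra.smul_def, ← hP, hd, List.map_reverse, List.map_map]
  congr 4
  exact List.map_congr_left fun i _ => hΨ i

theorem apolarEval_apply_powerWedge {n : ℕ}
    {Ψ : MvPolynomial (Fin n) ℚ →ₐ[ℚ] Module.End ℚ PolyWedge}
    (hΨ : ∀ i, Ψ (X i) = apolarOp ((i : ℕ) : ℚ)) {d : ℕ} {g : MvPolynomial (Fin n) ℚ} (hg : g.IsHomogeneous d)
    (h0 : ∀ m, 0 ≤ g.coeff m) :
    ∃ r : ℚ, Ψ g (powerWedge 1 d) = algebraMap ℚ PolyWedge r ∧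
      (r ≠ 0 ↔ HasSquareFreeMonomial d g) := by
  choose! r hr hΨr using apolarEval_monomial_squareFree hΨ
  have hdeg : ∀ m ∈ g.support, m.degree = d := fun m hm => by
    have := hg (mem_support_iff.1 hm)
    rw [Finsupp.degree_eq_weight_one (R := ℕ)]
    exact this
  classical
  -- The contribution of each monomial to the scalar; all are nonnegative, so the sum vanishes only
  -- if each of them does.
  let s := fun m : Fin n →₀ ℕ => if ∀ i, m i ≤ 1 then g.coeff m * r m else 0
  have hs : ∀ m, 0 ≤ s m := fun m => by
    simp only [s]
    split_ifs with h
    · exact mul_nonneg (h0 m) (hr m h).le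
    · exact le_rfl
  refine ⟨∑ m ∈ g.support, s m, ?_, ?_⟩
  · conv_lhs => rw [g.as_sum]
    rw [map_sum, LinearMap.sum_apply, map_sum]
    refine Finset.sum_congr rfl fun m hm => ?_
    simp only [s]
    split_ifs with h
    · rw [← hdeg m hm, hΨr m h]
    · rw [apolarEval_monomial_not_squareFree hΨ m _ h, map_zero, LinearMap.zero_apply]
  · rw [Ne, Finset.sum_eq_zero_iff_of_nonneg fun m _ => hs m]
    push Not
    constructor
    · rintro ⟨m, hm, hne⟩
      refine ⟨m, mem_support_iff.1 hm, hdeg m hm, ?_⟩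
      by_contra h
      exact hne (if_neg h)
    · rintro ⟨m, hm, -, h⟩
      refine ⟨m, mem_support_iff.2 hm, ?_⟩
      simp only [s, if_pos h]
      exact mul_ne_zero hm (hr m h).ne'

end ApolarEval

/-! ### Masks of bounded size and their enumeration -/

section Masks

/-- The number of bits of `J` plus its binary length: the number of cells of a path that a tiling
needs if the ones of `J` are dominoes and its zeros are monomers. -/
def maskSize (J : ℕ) : ℕ :=
  if _h : J = 0 then 0 else if J % 2 = 1 then maskSize (J / 2) + 2 else maskSize (J / 2) + 1
termination_by J
decreasing_by all_goals omega

@[simp] theorem maskSize_zero : maskSize 0 = 0 := by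
  rw [maskSize]; simp

theorem maskSize_odd (m : ℕ) : maskSize (2 * m + 1) = maskSize m + 2 := by
  rw [maskSize, dif_neg (by omega), if_pos (by omega)]
  congr 2; omega

theorem maskSize_even {m : ℕ} (hm : 0 < m) : maskSize (2 * m) = maskSize m + 1 := by
  rw [maskSize, dif_neg (by omega), if_neg (by omega)]
  congr 2; omega

theorem maskSize_even_le (m : ℕ) : maskSize (2 * m) ≤ maskSize m + 1 := by
  rcases Nat.eq_zero_or_pos m with rfl | hm
  · simp
  · exact (maskSize_even hm).le

theorem lt_two_pow_maskSize (J : ℕ) : J < 2 ^ maskSize J := by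
  induction J using Nat.strong_induction_on with
  | _ J ih =>
    obtain ⟨m, rfl | rfl⟩ := Nat.evenOdd_cases J
    · rcases Nat.eq_zero_or_pos m with rfl | hm
      · simp
      · have := ih m (by omega)
        rw [maskSize_even hm, pow_succ]; omega
    · have := ih m (by omega)
      rw [maskSize_odd, pow_succ, pow_succ]; omega

theorem maskSize_all_ones (d : ℕ) : maskSize (2 ^ d - 1) = 2 * d := by
  induction d with
  | zero => simp
  | succ d ih =>
    have := Nat.one_le_two_pow (n := d)
    rw [show 2 ^ (d + 1) - 1 = 2 * (2 ^ d - 1) + 1 by rw [pow_succ]; omega, maskSize_odd, ih]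
    ring

/-- One bit is lost, and the binary length does not grow. This unit of size is what the
multiplication by X - α may use up again. -/
theorem maskSize_sub_two_pow {J j : ℕ} (h : J.testBit j = true) :
    maskSize (J - 2 ^ j) + 1 ≤ maskSize J := by
  induction j generalizing J with
  | zero =>
    obtain ⟨m, rfl | rfl⟩ := Nat.evenOdd_cases J
    · simp at h
    · have := maskSize_even_le m
      rw [maskSize_odd, show 2 * m + 1 - 2 ^ 0 = 2 * m by simp]; omega
  | succ j ih =>
    obtain ⟨m, rfl | rfl⟩ := Nat.evenOdd_cases J
    · rw [Nat.testBit_even_succ] at h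
      have := Nat.two_pow_le_of_testBit h
      have h2 := maskSize_even_le (m - 2 ^ j)
      have h3 := ih h
      have h4 := Nat.one_le_two_pow (n := j)
      rw [show 2 * m - 2 ^ (j + 1) = 2 * (m - 2 ^ j) by rw [pow_succ]; omega,
        maskSize_even (by omega : 0 < m)]
      omega
    · rw [Nat.testBit_odd_succ] at h
      have := Nat.two_pow_le_of_testBit h
      have h3 := ih h
      rw [show 2 * m + 1 - 2 ^ (j + 1) = 2 * (m - 2 ^ j) + 1 by rw [pow_succ]; omega,
        maskSize_odd, maskSize_odd]
      omega

/-- Moving a bit to the free place above it keeps the number of bits. The length grows, by one, only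
when the top bit is moved. -/
theorem maskSize_add_two_pow {J j : ℕ} (h : J.testBit j = true)
    (h' : ¬ J.testBit (j + 1) = true) :
    maskSize (J + 2 ^ j) ≤ maskSize J + 1 ∧
      (2 ^ (j + 1) ≤ J → maskSize (J + 2 ^ j) ≤ maskSize J) := by
  induction j generalizing J with
  | zero =>
    obtain ⟨m, rfl | rfl⟩ := Nat.evenOdd_cases J
    · simp at h
    · rw [Nat.testBit_odd_succ] at h'
      obtain ⟨q, rfl | rfl⟩ := Nat.evenOdd_cases m
      · rw [show 2 * (2 * q) + 1 + 2 ^ 0 = 2 * (2 * q + 1) by ring, maskSize_even (by omega),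
          maskSize_odd, maskSize_odd]
        rcases Nat.eq_zero_or_pos q with rfl | hq
        · simp
        · rw [maskSize_even hq]
          omega
      · simp at h'
  | succ j ih =>
    obtain ⟨m, rfl | rfl⟩ := Nat.evenOdd_cases J
    · rw [Nat.testBit_even_succ] at h h'
      have := Nat.two_pow_le_of_testBit h
      have h3 := ih h h'
      have h4 := Nat.one_le_two_pow (n := j)
      rw [show 2 * m + 2 ^ (j + 1) = 2 * (m + 2 ^ j) by ring,
        maskSize_even (by omega : 0 < m), maskSize_even (by omega : 0 < m + 2 ^ j)]
      rw [pow_succ 2 (j + 1)]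
      omega
    · rw [Nat.testBit_odd_succ] at h h'
      have h3 := ih h h'
      rw [show 2 * m + 1 + 2 ^ (j + 1) = 2 * (m + 2 ^ j) + 1 by ring,
        maskSize_odd, maskSize_odd, pow_succ 2 (j + 1)]
      have h5 : 2 ^ (j + 1) = 2 * 2 ^ j := by ring
      omega

/-- The masks of size less than `k`. -/
def maskList : ℕ → List ℕ
  | 0 => []
  | 1 => [0]
  | k + 2 => (maskList k).map (fun x => 2 * x + 1) ++ (maskList (k + 1)).map (fun x => 2 * x)

/-- A lowest digit one uses two units of size and a zero one unit, which is the Fibonacci recursion.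
-/
theorem length_maskList : ∀ k, (maskList k).length = Nat.fib k
  | 0 => rfl
  | 1 => rfl
  | k + 2 => by
    rw [maskList, List.length_append, List.length_map, List.length_map, length_maskList k,
      length_maskList (k + 1), Nat.fib_add_two]

theorem mem_maskList : ∀ k m, m ∈ maskList k ↔ maskSize m < k
  | 0, m => by simp [maskList]
  | 1, m => by
    obtain ⟨q, rfl | rfl⟩ := Nat.evenOdd_cases m
    · rcases Nat.eq_zero_or_pos q with rfl | hq
      · simp [maskList]
      · rw [maskSize_even hq]; simp [maskList]; omega
    · rw [maskSize_odd]; simp [maskList]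
  | k + 2, m => by
    simp only [maskList, List.mem_append, List.mem_map, mem_maskList k, mem_maskList (k + 1)]
    obtain ⟨q, rfl | rfl⟩ := Nat.evenOdd_cases m
    · constructor
      · rintro (⟨x, hx, h⟩ | ⟨x, hx, h⟩)
        · omega
        · obtain rfl : x = q := by omega
          have := maskSize_even_le x
          omega
      · intro h
        refine Or.inr ⟨q, ?_, rfl⟩
        rcases Nat.eq_zero_or_pos q with rfl | hq
        · simp
        · rw [maskSize_even hq] at h; omega
    · rw [maskSize_odd]
      constructor
      · rintro (⟨x, hx, h⟩ | ⟨x, hx, h⟩)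
        · obtain rfl : x = q := by omega
          omega
        · omega
      · exact fun h => Or.inl ⟨q, by omega, rfl⟩

theorem nodup_maskList : ∀ k, (maskList k).Nodup
  | 0 => by simp [maskList]
  | 1 => by simp [maskList]
  | k + 2 => by
    rw [maskList]
    refine List.Nodup.append ((nodup_maskList k).map fun a b h => by simpa using h)
      ((nodup_maskList (k + 1)).map fun a b h => by simpa using h) ?_
    intro x hx hx'
    simp only [List.mem_map] at hx hx'
    obtain ⟨a, -, rfl⟩ := hx
    obtain ⟨b, -, hb⟩ := hx'
    omega

/-- The `i`-th mask of size less than `k`. -/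
def maskAt (k i : ℕ) : ℕ := (maskList k).getD i 0

theorem maskAt_lt_fib {k i : ℕ} (hi : i < Nat.fib k) :
    maskAt (k + 2) i = 2 * maskAt k i + 1 := by
  have h : i < (maskList k).length := by rwa [length_maskList]
  rw [maskAt, maskList, List.getD_append _ _ _ _ (by simpa using h)]
  simp [maskAt, h]

theorem maskAt_fib_add {k i : ℕ} (hi : i < Nat.fib (k + 1)) :
    maskAt (k + 2) (Nat.fib k + i) = 2 * maskAt (k + 1) i := by
  have h : i < (maskList (k + 1)).length := by rwa [length_maskList]
  have h2 : Nat.fib k = (maskList k).length := (length_maskList k).symm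
  rw [maskAt, maskList, List.getD_append_right _ _ _ _ (by simp [h2])]
  simp [maskAt, h2, h]

theorem maskAt_mem {k i : ℕ} (hi : i < Nat.fib k) : maskAt k i ∈ maskList k := by
  have h : i < (maskList k).length := by rwa [length_maskList]
  rw [maskAt, List.getD_eq_getElem _ _ h]
  exact List.getElem_mem h

theorem maskSize_maskAt {k i : ℕ} (hi : i < Nat.fib k) : maskSize (maskAt k i) < k :=
  (mem_maskList _ _).1 (maskAt_mem hi)

theorem maskAt_lt_two_pow {k i : ℕ} (hi : i < Nat.fib (k + 1)) : maskAt (k + 1) i < 2 ^ k :=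
  (lt_two_pow_maskSize _).trans_le
    (Nat.pow_le_pow_right two_pos (Nat.lt_succ_iff.1 (maskSize_maskAt hi)))

theorem exists_maskAt {k m : ℕ} (hm : maskSize m < k) : ∃ i < Nat.fib k, maskAt k i = m := by
  obtain ⟨i, hi, h⟩ := List.getElem_of_mem ((mem_maskList k m).2 hm)
  exact ⟨i, by rwa [← length_maskList], by rw [maskAt, List.getD_eq_getElem _ _ hi, h]⟩

theorem maskAt_injOn {k i j : ℕ} (hi : i < Nat.fib k) (hj : j < Nat.fib k)
    (h : maskAt k i = maskAt k j) : i = j := by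
  rw [← length_maskList] at hi hj
  rw [maskAt, maskAt, List.getD_eq_getElem _ _ hi, List.getD_eq_getElem _ _ hj] at h
  exact (nodup_maskList k).getElem_inj_iff.1 h

end Masks

/-! ### Coordinates of the operators -/

section Coordinates

open Polynomial

/-- The element of the exterior algebra with the coordinates `c` at the masks of size at most
`N`. -/
noncomputable def wedgeOf (N : ℕ) (c : ℕ → ℚ) : PolyWedge :=
  ∑ i ∈ Finset.range (Nat.fib (N + 1)),
    c (maskAt (N + 1) i) • maskWedge (fun j => (X : ℚ[X]) ^ j) (maskAt (N + 1) i)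

/-- The coordinates of a contraction of the wedge product with mask `J`, restricted to the first
`t` factors. -/
noncomputable def contractTerm (α : ℚ) (J t : ℕ) : ℕ →₀ ℚ :=
  ∑ j ∈ Finset.range t, if J.testBit j = true then
    Finsupp.single (J - 2 ^ j) (maskSign J j * α ^ j) else 0

/-- The coordinates of the contraction of the first `t` terms of `wedgeOf N c`. -/
noncomputable def contractSum (N : ℕ) (α : ℚ) (c : ℕ → ℚ) (t : ℕ) : ℕ →₀ ℚ :=
  ∑ i ∈ Finset.range t, c (maskAt (N + 1) i) • contractTerm α (maskAt (N + 1) i) N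

/-- The change of coordinates caused at the mask `J` by the replacement of `X ^ j` by
`X ^ (j + 1) - α X ^ j`. -/
noncomputable def raiseTerm (α : ℚ) (j J : ℕ) : ℕ →₀ ℚ :=
  if J.testBit j = true then
    (if J.testBit (j + 1) = true then 0 else Finsupp.single (J + 2 ^ j) 1) +
      Finsupp.single J (-α - 1)
  else 0

/-- The effect of this replacement at the first `t` masks. -/
noncomputable def raiseSum (N : ℕ) (α : ℚ) (j : ℕ) (c : ℕ →₀ ℚ) (t : ℕ) : ℕ →₀ ℚ :=
  c + ∑ i ∈ Finset.range t, c (maskAt (N + 1) i) • raiseTerm α j (maskAt (N + 1) i)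

/-- The coordinates after the first `t` replacements, made at the positions `N - 1, N - 2, …`. -/
noncomputable def raiseIter (N : ℕ) (α : ℚ) (c : ℕ →₀ ℚ) : ℕ → ℕ →₀ ℚ
  | 0 => c
  | t + 1 => raiseSum N α (N - 1 - t) (raiseIter N α c t) (Nat.fib (N + 1))

/-- Apart from its source, a replacement at j only changes masks whose bit j is clear, and those are
never sources. Hence the pass can be made in place, in any order of the masks. -/
theorem raiseTerm_apply_of_testBit {α : ℚ} {j J J' : ℕ} (h : J.testBit j = true)
    (hne : J' ≠ J) : raiseTerm α j J' J = 0 := by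
  rw [raiseTerm]
  split_ifs with h1 h2
  · simp [hne]
  · rw [Finsupp.add_apply, Finsupp.single_eq_of_ne (Ne.symm hne), Finsupp.single_eq_of_ne, add_zero]
    rintro rfl
    -- Adding `2 ^ j` flips bit j.
    rw [Nat.add_comm, Nat.testBit_two_pow_add_eq, h1] at h
    simp at h
  · rfl

theorem raiseSum_apply_maskAt {N : ℕ} {α : ℚ} {j t : ℕ} {c : ℕ →₀ ℚ} (ht : t < Nat.fib (N + 1))
    (h : (maskAt (N + 1) t).testBit j = true) :
    raiseSum N α j c t (maskAt (N + 1) t) = c (maskAt (N + 1) t) := by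
  rw [raiseSum, Finsupp.add_apply, Finsupp.finsetSum_apply, Finset.sum_eq_zero, add_zero]
  intro i hi
  have hi := Finset.mem_range.1 hi
  rw [Finsupp.smul_apply, raiseTerm_apply_of_testBit h, smul_zero]
  intro he
  exact hi.ne (maskAt_injOn (hi.trans ht) ht he)

theorem linearCombination_eq_sum_maskAt {M : Type*} [AddCommGroup M] [Module ℚ M] (N : ℕ)
    (f : ℕ → M) (c : ℕ →₀ ℚ) (hc : ∀ J, c J ≠ 0 → maskSize J ≤ N) :
    Finsupp.linearCombination ℚ f c =
      ∑ i ∈ Finset.range (Nat.fib (N + 1)), c (maskAt (N + 1) i) • f (maskAt (N + 1) i) := by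
  have hinj : Set.InjOn (maskAt (N + 1)) (Finset.range (Nat.fib (N + 1)) : Set ℕ) :=
    fun i hi j hj h => maskAt_injOn (by simpa using hi) (by simpa using hj) h
  rw [← Finset.sum_image (f := fun J => c J • f J) hinj, Finsupp.linearCombination_apply,
    Finsupp.sum]
  refine Finset.sum_subset (fun J hJ => ?_) fun J _ hJ => by
    rw [Finsupp.notMem_support_iff.1 hJ, zero_smul]
  obtain ⟨i, hi, h⟩ := exists_maskAt
    (Nat.lt_succ_of_le (hc J (Finsupp.mem_support_iff.1 hJ)))
  exact Finset.mem_image.2 ⟨i, Finset.mem_range.2 hi, h⟩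

theorem linearCombination_raiseTerm {α : ℚ} {j : ℕ} {b b' : ℕ → ℚ[X]}
    (hne : ∀ i, i ≠ j → b' i = b i) (hj : b' j = b (j + 1) + (-α) • b j) (J : ℕ) :
    Finsupp.linearCombination ℚ (maskWedge b) (raiseTerm α j J) =
      maskWedge b' J - maskWedge b J := by
  rw [maskWedge_replace j (-α) hne hj, raiseTerm]
  split_ifs
  all_goals simp
  abel

/-- For each mask, `raiseTerm` is the difference between the wedge of the old family and that of the
new one, written in the new family. The size bound guarantees that the list of masks misses no
coordinate. -/
theorem linearCombination_raiseSum {N : ℕ} {α : ℚ} {j : ℕ} {b b' : ℕ → ℚ[X]}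
    (hne : ∀ i, i ≠ j → b' i = b i) (hj : b' j = b (j + 1) + (-α) • b j) {c : ℕ →₀ ℚ}
    (hc : ∀ J, c J ≠ 0 → maskSize J ≤ N) :
    Finsupp.linearCombination ℚ (maskWedge b) (raiseSum N α j c (Nat.fib (N + 1))) =
      Finsupp.linearCombination ℚ (maskWedge b') c := by
  rw [raiseSum, map_add, map_sum, linearCombination_eq_sum_maskAt N _ c hc,
    linearCombination_eq_sum_maskAt N _ c hc, ← Finset.sum_add_distrib]
  refine Finset.sum_congr rfl fun i _ => ?_
  rw [map_smul, linearCombination_raiseTerm hne hj, ← smul_add, add_sub_cancel]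

/-- The invariant keeps one unit of size in reserve for the masks below `2 ^ (j + 1)`, whose top bit
has not been moved. Moving the top bit spends this unit; moving a lower bit costs nothing. -/
theorem maskSize_of_raiseSum_ne_zero {N : ℕ} {α : ℚ} {j : ℕ} {c : ℕ →₀ ℚ}
    (hc : ∀ J, c J ≠ 0 → maskSize J ≤ N ∧ (J < 2 ^ (j + 1) → maskSize J + 1 ≤ N)) (J : ℕ)
    (hJ : raiseSum N α j c (Nat.fib (N + 1)) J ≠ 0) :
    maskSize J ≤ N ∧ (J < 2 ^ j → maskSize J + 1 ≤ N) := by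
  have hpow : 2 ^ (j + 1) = 2 * 2 ^ j := by ring
  by_cases h0 : c J = 0
  · rw [raiseSum, Finsupp.add_apply, h0, zero_add, Finsupp.finsetSum_apply] at hJ
    obtain ⟨i, -, hi⟩ := Finset.exists_ne_zero_of_sum_ne_zero hJ
    set J' := maskAt (N + 1) i
    have hne : J' ≠ J := by
      rintro h
      rw [Finsupp.smul_apply, h, h0, zero_smul] at hi
      exact hi rfl
    rw [Finsupp.smul_apply, smul_eq_mul, raiseTerm] at hi
    obtain ⟨h1, h2⟩ := mul_ne_zero_iff.1 hi
    obtain ⟨h3, h4⟩ := hc _ h1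
    split_ifs at h2 with h5 h6
    · simp [hne] at h2
    · obtain rfl : J = J' + 2 ^ j := by
        by_contra hcon
        rw [Finsupp.add_apply, Finsupp.single_eq_of_ne hcon,
          Finsupp.single_eq_of_ne (Ne.symm hne)] at h2
        simp at h2
      have h7 := maskSize_add_two_pow h5 h6
      omega
    · simp at h2
  · obtain ⟨h3, h4⟩ := hc _ h0
    exact ⟨h3, fun h => h4 (by omega)⟩

/-- The family `X ^ i * (X - α)` for `i < j`, and `X ^ i` for `i ≥ j`. -/
noncomputable def mixedPowers (α : ℚ) (j i : ℕ) : ℚ[X] :=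
  if i < j then (X - C α) * X ^ i else X ^ i

/-- The positions are treated from the top down: (X - α)X^j is expanded into X^(j+1) and X^j, so
position j + 1 must already carry a pure power. -/
theorem raiseIter_spec {N : ℕ} {α : ℚ} {c : ℕ →₀ ℚ} (hc : ∀ J, c J ≠ 0 → maskSize J + 1 ≤ N)
    (t : ℕ) (ht : t ≤ N) :
    (∀ J, raiseIter N α c t J ≠ 0 →
      maskSize J ≤ N ∧ (J < 2 ^ (N - t) → maskSize J + 1 ≤ N)) ∧
    Finsupp.linearCombination ℚ (maskWedge (mixedPowers α (N - t))) (raiseIter N α c t) =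
      Finsupp.linearCombination ℚ (maskWedge (mixedPowers α N)) c := by
  induction t with
  | zero => exact ⟨fun J hJ => ⟨(hc J hJ).trans' (Nat.le_succ _), fun _ => hc J hJ⟩, rfl⟩
  | succ t ih =>
    obtain ⟨h1, h2⟩ := ih (by omega)
    have hj : N - t = (N - 1 - t) + 1 := by omega
    rw [hj] at h1 h2
    rw [show N - (t + 1) = N - 1 - t by omega]
    refine ⟨maskSize_of_raiseSum_ne_zero h1, ?_⟩
    rw [← h2]
    refine linearCombination_raiseSum (fun i hi => ?_) ?_ fun J hJ => (h1 J hJ).1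
    · simp only [mixedPowers]
      congr 1
      exact propext ⟨fun _ => by omega, fun _ => by omega⟩
    · simp only [mixedPowers, if_pos (Nat.lt_succ_self _), lt_irrefl, if_false,
        if_neg (Nat.not_succ_lt_self)]
      rw [Polynomial.smul_eq_C_mul, C_neg]; ring

theorem contractSum_ne_zero {N : ℕ} {α : ℚ} {c : ℕ → ℚ} {J : ℕ} {t : ℕ} (ht : t ≤ Nat.fib (N + 1))
    (hJ : contractSum N α c t J ≠ 0) : maskSize J + 1 ≤ N := by
  rw [contractSum, Finsupp.finsetSum_apply] at hJ
  obtain ⟨i, hi, hJ⟩ := Finset.exists_ne_zero_of_sum_ne_zero hJ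
  have hi := Finset.mem_range.1 hi
  rw [Finsupp.smul_apply, smul_eq_mul, contractTerm, Finsupp.finsetSum_apply] at hJ
  obtain ⟨j, -, hJ⟩ := Finset.exists_ne_zero_of_sum_ne_zero (mul_ne_zero_iff.1 hJ).2
  split_ifs at hJ with h
  · obtain rfl : J = maskAt (N + 1) i - 2 ^ j := by
      by_contra hcon
      rw [Finsupp.single_eq_of_ne hcon] at hJ
      exact hJ rfl
    have h1 := maskSize_sub_two_pow h
    have h2 := maskSize_maskAt (hi.trans_le ht)
    omega
  · simp at hJ

theorem linearCombination_contractSum (N : ℕ) (α : ℚ) (c : ℕ → ℚ) :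
    Finsupp.linearCombination ℚ (maskWedge fun j => (X : ℚ[X]) ^ j)
      (contractSum N α c (Nat.fib (N + 1))) = evalContract α (wedgeOf N c) := by
  rw [contractSum, wedgeOf, map_sum, map_sum]
  refine Finset.sum_congr rfl fun i hi => ?_
  rw [map_smul, map_smul, evalContract,
    contractLeft_maskWedge _ N _ _ (maskAt_lt_two_pow (Finset.mem_range.1 hi)), contractTerm,
    map_sum]
  congr 1
  refine Finset.sum_congr rfl fun j _ => ?_
  split_ifs
  · rw [Finsupp.linearCombination_single]; simp
  · exact map_zero _

/-- The coordinates of `apolarOp α (wedgeOf N c)`. -/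
noncomputable def apolarCoord (N : ℕ) (α : ℚ) (c : ℕ → ℚ) : ℕ →₀ ℚ :=
  raiseIter N α (contractSum N α c (Nat.fib (N + 1))) N

theorem apolarCoord_ne_zero {N : ℕ} {α : ℚ} {c : ℕ → ℚ} {J : ℕ} (hJ : apolarCoord N α c J ≠ 0) :
    maskSize J ≤ N :=
  ((raiseIter_spec (fun _ => contractSum_ne_zero le_rfl) N le_rfl).1 J hJ).1

/-- After all N replacements the family consists of pure powers. Before them it is X - α times the
powers only at positions below N, which suffices because the masks left by the contraction are less
than `2 ^ N`. -/
theorem wedgeOf_apolarCoord (N : ℕ) (α : ℚ) (c : ℕ → ℚ) :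
    wedgeOf N (apolarCoord N α c) = apolarOp α (wedgeOf N c) := by
  have h := (raiseIter_spec (α := α) (c := contractSum N α c (Nat.fib (N + 1)))
    (fun _ => contractSum_ne_zero le_rfl) N le_rfl).2
  have h0 : mixedPowers α (N - N) = fun j => (X : ℚ[X]) ^ j := by
    funext i; simp [mixedPowers]
  rw [wedgeOf, ← linearCombination_eq_sum_maskAt N _ _ fun J hJ => apolarCoord_ne_zero hJ,
    apolarCoord, ← h0, h, apolarOp, LinearMap.comp_apply, ← linearCombination_contractSum,
    AlgHom.toLinearMap_apply, Finsupp.linearCombination_apply, Finsupp.linearCombination_apply,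
    Finsupp.sum, Finsupp.sum, map_sum]
  refine Finset.sum_congr rfl fun J hJ => ?_
  rw [map_smul, maskWedge_map]
  congr 1
  refine maskWedge_congr fun i hi => ?_
  have h1 := contractSum_ne_zero le_rfl (Finsupp.mem_support_iff.1 hJ)
  have h2 := (lt_two_pow_maskSize J).trans_le
    (Nat.pow_le_pow_right two_pos (by omega : maskSize J ≤ N))
  have h3 := (Nat.pow_lt_pow_iff_right one_lt_two).1 ((Nat.two_pow_le_of_testBit hi).trans_lt h2)
  rw [mixedPowers, if_pos h3, LinearMap.mulLeft_apply]

theorem wedgeOf_congr {N : ℕ} {c c' : ℕ → ℚ}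
    (h : ∀ i < Nat.fib (N + 1), c (maskAt (N + 1) i) = c' (maskAt (N + 1) i)) :
    wedgeOf N c = wedgeOf N c' :=
  Finset.sum_congr rfl fun i hi => by rw [h i (Finset.mem_range.1 hi)]

theorem wedgeOf_add (N : ℕ) (c c' : ℕ → ℚ) :
    wedgeOf N (fun J => c J + c' J) = wedgeOf N c + wedgeOf N c' := by
  simp [wedgeOf, add_smul, Finset.sum_add_distrib]

theorem wedgeOf_const_mul (N : ℕ) (a : ℚ) (c : ℕ → ℚ) :
    wedgeOf N (fun J => a * c J) = a • wedgeOf N c := by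
  simp [wedgeOf, mul_smul, Finset.smul_sum]

/-- The mask of the start vector has d bits and length d; this fixes the size bound 2d. -/
theorem wedgeOf_single (d : ℕ) :
    wedgeOf (2 * d) (Finsupp.single (2 ^ d - 1) 1) = powerWedge 1 d := by
  rw [wedgeOf, ← linearCombination_eq_sum_maskAt]
  · simp [powerWedge]
  · intro J hJ
    obtain rfl : J = 2 ^ d - 1 := by
      by_contra hcon
      rw [Finsupp.single_eq_of_ne hcon] at hJ
      exact hJ rfl
    exact (maskSize_all_ones d).le

/-- The projection to scalars kills all nonempty wedges; it is used to read the final scalar from a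
single memory cell. -/
theorem algebraMapInv_wedgeOf (N : ℕ) (c : ℕ → ℚ) :
    ExteriorAlgebra.algebraMapInv (wedgeOf N c) = c 0 := by
  obtain ⟨i, hi, h⟩ := exists_maskAt (k := N + 1) (m := 0) (by simp)
  rw [wedgeOf, map_sum, Finset.sum_eq_single_of_mem i (Finset.mem_range.2 hi)]
  · rw [h]; simp
  · intro j hj hne
    rw [map_smul, algebraMapInv_maskWedge, smul_zero]
    rw [← h]
    exact fun he => hne (maskAt_injOn (Finset.mem_range.1 hj) hi he)

end Coordinates

/-! ### Hoare logic with time bounds -/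

namespace RAM

/-- With word bound `W`, the program `P` started in `s` halts within `T` steps in a state
satisfying `Q`. -/
def Triple (W : ℕ) (P : Prog) (s : State) (T : ℕ) (Q : State → Prop) : Prop :=
  ∃ t s', Exec W P s t s' ∧ t ≤ T ∧ Q s'

/-- The sequence of the given elementary instructions. -/
def block : List Instr → Prog
  | [] => .skip
  | [i] => .instr i
  | i :: j :: l => .seq (.instr i) (block (j :: l))

/-- An upper bound for the number of steps of a program without loops. -/
def Prog.cost : Prog → ℕ
  | .skip => 1
  | .instr _ => 1
  | .seq P Q => P.cost + Q.cost
  | .ite _ P Q => max P.cost Q.cost + 1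
  | .loop _ _ => 0

/-- The weakest precondition of a program without loops. -/
def Prog.wp (W : ℕ) : Prog → (State → Prop) → State → Prop
  | .skip, Q, s => Q s
  | .instr i, Q, s => i.Fits W s ∧ Q (i.run s)
  | .seq P P', Q, s => P.wp W (P'.wp W Q) s
  | .ite b P P', Q, s => (b.Holds s → P.wp W Q s) ∧ (¬ b.Holds s → P'.wp W Q s)
  | .loop _ _, _, _ => False

variable {W : ℕ} {P P' : Prog} {s : State} {T T₁ T₂ : ℕ} {Q R : State → Prop}

theorem Triple.mono (h : Triple W P s T Q) (hT : T ≤ T₁) (hQ : ∀ s, Q s → R s) :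
    Triple W P s T₁ R := by
  obtain ⟨t, s', h1, h2, h3⟩ := h
  exact ⟨t, s', h1, h2.trans hT, hQ _ h3⟩

theorem Triple.seq (h : Triple W P s T₁ R) (h' : ∀ s', R s' → Triple W P' s' T₂ Q)
    (hT : T₁ + T₂ ≤ T) : Triple W (.seq P P') s T Q := by
  obtain ⟨t, s', h1, h2, h3⟩ := h
  obtain ⟨t', s'', h4, h5, h6⟩ := h' _ h3
  exact ⟨t + t', s'', .seq h1 h4, by omega, h6⟩

theorem Triple.ite {b : Test} (h : b.Holds s → Triple W P s T₁ Q)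
    (h' : ¬ b.Holds s → Triple W P' s T₁ Q) (hT : T₁ + 1 ≤ T) :
    Triple W (.ite b P P') s T Q := by
  by_cases hb : b.Holds s
  · obtain ⟨t, s', h1, h2, h3⟩ := h hb
    exact ⟨t + 1, s', .iteTrue hb h1, by omega, h3⟩
  · obtain ⟨t, s', h1, h2, h3⟩ := h' hb
    exact ⟨t + 1, s', .iteFalse hb h1, by omega, h3⟩

theorem Triple.of_wp (h : P.wp W Q s) (hT : P.cost ≤ T) : Triple W P s T Q := by
  induction P generalizing s T Q with
  | skip => exact ⟨1, s, .skip s, hT, h⟩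
  | instr i => exact ⟨1, _, .instr i s h.1, hT, h.2⟩
  | seq P P' ih ih' => exact (ih h le_rfl).seq (fun s' hs' => ih' hs' le_rfl) hT
  | ite b P P' ih ih' =>
    exact .ite (fun hb => ih (h.1 hb) (le_max_left _ _)) (fun hb => ih' (h.2 hb) (le_max_right _ _))
      hT
  | loop b P => exact h.elim

theorem Triple.of_wp_seq (h : P.wp W (fun s' => Triple W P' s' T₁ Q) s) (hT : P.cost + T₁ ≤ T) :
    Triple W (.seq P P') s T Q :=
  (Triple.of_wp h le_rfl).seq (fun _ h => h) hT

/-- A loop whose `k`-th iteration leads from the invariant `I k` to `I (k + 1)`. -/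
theorem Triple.loop {b : Test} (N T₀ : ℕ) (I : ℕ → State → Prop) (h0 : I 0 s)
    (hstep : ∀ k < N, ∀ s, I k s → b.Holds s ∧ Triple W P s T₀ (I (k + 1)))
    (hend : ∀ s, I N s → ¬ b.Holds s) (hT : N * (T₀ + 1) + 1 ≤ T) :
    Triple W (.loop b P) s T (I N) := by
  suffices h : ∀ m k, k + m = N → ∀ s, I k s → Triple W (.loop b P) s (m * (T₀ + 1) + 1) (I N) from
    (h N 0 (zero_add N) s h0).mono hT fun _ h => h
  intro m
  induction m with
  | zero =>
    rintro k rfl s hs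
    exact ⟨1, s, .loopDone (hend s hs), by omega, hs⟩
  | succ m ih =>
    intro k hk s hs
    obtain ⟨hb, t, s', h1, h2, h3⟩ := hstep k (by omega) s hs
    obtain ⟨t', s'', h4, h5, h6⟩ := ih (k + 1) (by omega) s' h3
    refine ⟨t + t' + 1, s'', .loopStep hb h1 h4, ?_, h6⟩
    rw [Nat.succ_mul]; omega

namespace State

variable (s : State) (r r' A A' i v : ℕ) (q : ℚ)

@[simp] theorem setW_wreg : (s.setW r v).wreg r' = if r' = r then v else s.wreg r' :=
  Function.update_apply ..

@[simp] theorem setW_warr : (s.setW r v).warr = s.warr := rfl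

@[simp] theorem setW_qreg : (s.setW r v).qreg = s.qreg := rfl

@[simp] theorem setW_qarr : (s.setW r v).qarr = s.qarr := rfl

@[simp] theorem setQ_qreg : (s.setQ r q).qreg r' = if r' = r then q else s.qreg r' :=
  Function.update_apply ..

@[simp] theorem setQ_warr : (s.setQ r q).warr = s.warr := rfl

@[simp] theorem setQ_wreg : (s.setQ r q).wreg = s.wreg := rfl

@[simp] theorem setQ_qarr : (s.setQ r q).qarr = s.qarr := rfl

@[simp] theorem setWArr_warr : (s.setWArr A i v).warr A' =
    if A' = A then Function.update (s.warr A) i v else s.warr A' :=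
  Function.update_apply ..

@[simp] theorem setWArr_wreg : (s.setWArr A i v).wreg = s.wreg := rfl

@[simp] theorem setWArr_qreg : (s.setWArr A i v).qreg = s.qreg := rfl

@[simp] theorem setWArr_qarr : (s.setWArr A i v).qarr = s.qarr := rfl

@[simp] theorem setQArr_qarr : (s.setQArr A i q).qarr A' =
    if A' = A then Function.update (s.qarr A) i q else s.qarr A' :=
  Function.update_apply ..

@[simp] theorem setQArr_wreg : (s.setQArr A i q).wreg = s.wreg := rfl

@[simp] theorem setQArr_qreg : (s.setQArr A i q).qreg = s.qreg := rfl

@[simp] theorem setQArr_warr : (s.setQArr A i q).warr = s.warr := rfl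

end State

end RAM

/-! ### Evaluation of the circuit at `(1, …, 1)` and `(2, …, 2)`, and the degree -/

namespace ArithCircuit

variable {n : ℕ} (C : ArithCircuit n) {k : ℕ} (hk : k < C.size)

theorem gatePoly_var {i : Fin n} (hg : C.gate ⟨k, hk⟩ = .var i) :
    C.gatePoly k hk = MvPolynomial.X i := by
  rw [gatePoly]; split <;> simp_all

theorem gatePoly_scalar {c : ℚ} (hg : C.gate ⟨k, hk⟩ = .scalar c) :
    C.gatePoly k hk = MvPolynomial.C c := by
  rw [gatePoly]; split <;> simp_all

theorem gatePoly_add {a b : Fin k} (hg : C.gate ⟨k, hk⟩ = .add a b) :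
    C.gatePoly k hk =
      C.gatePoly a (a.isLt.trans hk) + C.gatePoly b (b.isLt.trans hk) := by
  rw [gatePoly]; split <;> simp_all

theorem gatePoly_mul {a b : Fin k} (hg : C.gate ⟨k, hk⟩ = .mul a b) :
    C.gatePoly k hk =
      C.gatePoly a (a.isLt.trans hk) * C.gatePoly b (b.isLt.trans hk) := by
  rw [gatePoly]; split <;> simp_all

theorem input_warr_zero : C.input.warr 0 k = (C.gate ⟨k, hk⟩).code.1 := by
  simp [input, hk]

theorem input_warr_one : C.input.warr 1 k = (C.gate ⟨k, hk⟩).code.2.1 := by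
  simp [input, hk]

theorem input_warr_two : C.input.warr 2 k = (C.gate ⟨k, hk⟩).code.2.2 := by
  simp [input, hk]

theorem input_qarr_zero : C.input.qarr 0 k = (C.gate ⟨k, hk⟩).scalarPart := by
  simp [input, hk]

end ArithCircuit

namespace RAM

/-- The input is intact, and the registers for constants are set. -/
def InputMem {n : ℕ} (C : ArithCircuit n) (s : State) : Prop :=
  (s.wreg 0 = n ∧ s.wreg 1 = C.size ∧ s.wreg 2 = C.out ∧ s.wreg 3 = 1 ∧ s.wreg 4 = 2 ∧
    s.wreg 5 = 0) ∧ (s.qreg 0 = 0 ∧ s.qreg 1 = 1 ∧ s.qreg 2 = 2) ∧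
  (s.warr 0 = C.input.warr 0 ∧ s.warr 1 = C.input.warr 1 ∧ s.warr 2 = C.input.warr 2) ∧
  s.qarr 0 = C.input.qarr 0

section InputMem

variable {n : ℕ} {C : ArithCircuit n} {s : State} {r A i v : ℕ} {q : ℚ}

@[simp] theorem inputMem_setW (h : 6 ≤ r) : InputMem C (s.setW r v) ↔ InputMem C s := by
  have h0 : 0 ≠ r := by omega
  have h1 : 1 ≠ r := by omega
  have h2 : 2 ≠ r := by omega
  have h3 : 3 ≠ r := by omega
  have h4 : 4 ≠ r := by omega
  have h5 : 5 ≠ r := by omega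
  simp [InputMem, h0, h1, h2, h3, h4, h5]

@[simp] theorem inputMem_setQ (h : 3 ≤ r) : InputMem C (s.setQ r q) ↔ InputMem C s := by
  have h0 : 0 ≠ r := by omega
  have h1 : 1 ≠ r := by omega
  have h2 : 2 ≠ r := by omega
  simp [InputMem, h0, h1, h2]

@[simp] theorem inputMem_setWArr (h : 3 ≤ A) : InputMem C (s.setWArr A i v) ↔ InputMem C s := by
  have h0 : 0 ≠ A := by omega
  have h1 : 1 ≠ A := by omega
  have h2 : 2 ≠ A := by omega
  simp [InputMem, h0, h1, h2]

@[simp] theorem inputMem_setQArr (h : 1 ≤ A) : InputMem C (s.setQArr A i q) ↔ InputMem C s := by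
  have h0 : 0 ≠ A := by omega
  simp [InputMem, h0]

end InputMem

/-- Store the values of gate `w₁₂`, and go to the next gate. -/
def evalStore : Prog := block [.qstore 4 12 10, .qstore 5 12 11, .wop .add 12 12 3]

/-- Compute and store the values of gate `w₁₂` at `(1, …, 1)` and `(2, …, 2)`. -/
def evalStep : Prog :=
  .seq (block [.wload 20 0 12, .wload 21 1 12, .wload 22 2 12]) <|
  .seq (.ite (.weq 20 5) (block [.qop .add 10 1 0, .qop .add 11 2 0]) <|
    .ite (.weq 20 3) (block [.qload 10 0 12, .qload 11 0 12]) <|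
    .seq (block [.qload 12 4 21, .qload 13 4 22, .qload 14 5 21, .qload 15 5 22])
      (.ite (.weq 20 4) (block [.qop .add 10 12 13, .qop .add 11 14 15])
        (block [.qop .mul 10 12 13, .qop .mul 11 14 15])))
  evalStore

/-- The first `t` gates are evaluated. -/
def EvalInv {n : ℕ} (C : ArithCircuit n) (t : ℕ) (s : State) : Prop :=
  InputMem C s ∧ s.wreg 12 = t ∧ s.warr 3 = (fun _ => 0) ∧ s.qarr 1 = (fun _ => 0) ∧
  s.qarr 2 = (fun _ => 0) ∧
  (∀ k (hk : k < C.size), k < t →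
    s.qarr 4 k = MvPolynomial.eval (fun _ => 1) (C.gatePoly k hk)) ∧
  ∀ k (hk : k < C.size), k < t →
    s.qarr 5 k = MvPolynomial.eval (fun _ => 2) (C.gatePoly k hk)

theorem evalStep_spec {n : ℕ} (C : ArithCircuit n) {W t : ℕ} {s : State} (hn : n + 3 ≤ W)
    (hs : C.size + 3 ≤ W) (ht : t < C.size) (h : EvalInv C t s) :
    Triple W evalStep s 20 (EvalInv C (t + 1)) := by
  obtain ⟨hI, h12, ha3, hq1, hq2, h4, h5⟩ := h
  have hI' := hI
  obtain ⟨⟨w0, w1, w2, w3, w4, w5⟩, ⟨q0, q1, q2⟩, ⟨a0, a1, a2⟩, b0⟩ := hI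
  -- All kinds of gates end with the same store, which is treated once here.
  have key : ∀ (u v : ℚ) (s' : State), InputMem C s' → s'.wreg 12 = t → s'.warr 3 = s.warr 3 →
      s'.qarr = s.qarr → s'.qreg 10 = u → s'.qreg 11 = v →
      u = MvPolynomial.eval (fun _ => 1) (C.gatePoly t ht) →
      v = MvPolynomial.eval (fun _ => 2) (C.gatePoly t ht) →
      evalStore.wp W (EvalInv C (t + 1)) s' := by
    intro u v s' i1 i2 i3 i4 i5 i6 i7 i8
    have i1' := i1
    obtain ⟨⟨-, -, -, w3, -, -⟩, -, -, -⟩ := i1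
    simp [evalStore, block, Prog.wp, Instr.Fits, Instr.run, WOp.eval, i2, w3]
    refine ⟨by omega, by omega, ?_⟩
    simp only [EvalInv]
    simp [i1', i3, i4, i5, i6, ha3, hq1, hq2, Function.update_apply]
    constructor
    · intro k hk hkt
      split_ifs with hc
      · subst hc; exact i7
      · exact h4 k hk (by omega)
    · intro k hk hkt
      split_ifs with hc
      · subst hc; exact i8
      · exact h5 k hk (by omega)
  refine Triple.of_wp ?_ (by decide)
  have e0 := C.input_warr_zero ht
  have e1 := C.input_warr_one ht
  have e2 := C.input_warr_two ht
  have e3 := C.input_qarr_zero ht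
  have htW : t ≤ W := by omega
  obtain ⟨hW1, hW2, hW3⟩ : 1 ≤ W ∧ 2 ≤ W ∧ 3 ≤ W := by omega
  rw [evalStep]
  cases hg : C.gate ⟨t, ht⟩ with
  | var i =>
    have hiW : (i : ℕ) ≤ W := by omega
    simp only [hg, Gate.code] at e0 e1 e2
    simp [block, Prog.wp, Instr.Fits, Instr.run, QOp.eval, Test.Holds, h12, e0, e1, e2, a0, a1, a2,
      w5, htW, hiW]
    refine key 1 2 _ ?_ ?_ ?_ ?_ ?_ ?_ ?_ ?_ <;>
      simp [hI', h12, q0, q1, q2, C.gatePoly_var ht hg]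
  | scalar c =>
    simp only [hg, Gate.code, Gate.scalarPart] at e0 e1 e2 e3
    simp [block, Prog.wp, Instr.Fits, Instr.run, QOp.eval, Test.Holds, h12, e0, e1, e2, a0, a1, a2,
      w3, w5, htW, hW1]
    refine key c c _ ?_ ?_ ?_ ?_ ?_ ?_ ?_ ?_ <;>
      simp [hI', h12, b0, e3, C.gatePoly_scalar ht hg]
  | add a b =>
    have haW : (a : ℕ) ≤ W := by omega
    have hbW : (b : ℕ) ≤ W := by omega
    simp only [hg, Gate.code] at e0 e1 e2
    simp [block, Prog.wp, Instr.Fits, Instr.run, QOp.eval, Test.Holds, h12, e0, e1, e2, a0, a1, a2,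
      w3, w4, w5, htW, haW, hbW, hW2]
    refine key _ _ _ ?_ ?_ ?_ ?_ rfl rfl ?_ ?_ <;>
      simp [hI', h12, h4 a (a.isLt.trans ht) a.isLt, h4 b (b.isLt.trans ht) b.isLt,
        h5 a (a.isLt.trans ht) a.isLt, h5 b (b.isLt.trans ht) b.isLt, C.gatePoly_add ht hg]
  | mul a b =>
    have haW : (a : ℕ) ≤ W := by omega
    have hbW : (b : ℕ) ≤ W := by omega
    simp only [hg, Gate.code] at e0 e1 e2
    simp [block, Prog.wp, Instr.Fits, Instr.run, QOp.eval, Test.Holds, h12, e0, e1, e2, a0, a1, a2,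
      w3, w4, w5, htW, haW, hbW, hW3]
    refine key _ _ _ ?_ ?_ ?_ ?_ rfl rfl ?_ ?_ <;>
      simp [hI', h12, h4 a (a.isLt.trans ht) a.isLt, h4 b (b.isLt.trans ht) b.isLt,
        h5 a (a.isLt.trans ht) a.isLt, h5 b (b.isLt.trans ht) b.isLt, C.gatePoly_mul ht hg]

theorem evalLoop_spec {n : ℕ} (C : ArithCircuit n) {W : ℕ} {s : State} (hn : n + 3 ≤ W)
    (hs : C.size + 3 ≤ W) (h : EvalInv C 0 s) :
    Triple W (.loop (.wlt 12 1) evalStep) s (C.size * 21 + 1) (EvalInv C C.size) := by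
  refine Triple.loop C.size 20 (EvalInv C) h (fun t ht s' h' => ⟨?_, evalStep_spec C hn hs ht h'⟩)
    (fun s' h' => ?_) le_rfl
  · simp only [Test.Holds, h'.2.1, h'.1.1.2.1, ht]
  · simp only [Test.Holds, h'.2.1, h'.1.1.2.1, lt_irrefl, not_false_iff]

/-- Set the registers for constants. -/
def initBlock : Prog := block [.wconst 3 1, .wconst 4 2, .qconst 1 1, .qconst 2 2]

theorem initBlock_spec {n : ℕ} (C : ArithCircuit n) {W : ℕ} (hW : 2 ≤ W) :
    Triple W initBlock C.input 4 (EvalInv C 0) := by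
  refine Triple.of_wp ?_ (by decide)
  have : 1 ≤ W := by omega
  simp [initBlock, block, Prog.wp, Instr.Fits, Instr.run, this, hW, EvalInv, InputMem]
  simp [ArithCircuit.input]

/-- Load the values of the output gate, and prepare the search for the degree. -/
def degreePrep : Prog :=
  block [.qload 20 4 2, .qload 21 5 2, .wop .add 6 0 3, .wop .add 13 0 3, .wop .add 12 5 5]

/-- If `2 ^ t * g(1, …, 1) = g(2, …, 2)`, where `t = w₁₂`, then set `w₆` to `t`. -/
def degreeStep : Prog :=
  .seq (block [.qop .sub 22 20 21]) <|
  .seq (.ite (.qzero 22) (block [.wop .add 6 12 5]) .skip) <|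
  block [.qop .add 20 20 20, .wop .add 12 12 3]

/-- The candidates below `t` for the degree `d` have been tested. -/
def DegreeInv {n : ℕ} (C : ArithCircuit n) (d : ℕ) (u : ℚ) (t : ℕ) (s : State) : Prop :=
  InputMem C s ∧ s.wreg 12 = t ∧ s.wreg 13 = n + 1 ∧ s.wreg 6 = (if d < t then d else n + 1) ∧
  s.qreg 20 = u * 2 ^ t ∧ s.qreg 21 = u * 2 ^ d ∧
  s.warr 3 = (fun _ => 0) ∧ s.qarr 1 = (fun _ => 0) ∧ s.qarr 2 = (fun _ => 0)

theorem eval_two_eq {n d : ℕ} {g : MvPolynomial (Fin n) ℚ} (hg : g.IsHomogeneous d) :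
    MvPolynomial.eval (fun _ => 2) g = MvPolynomial.eval (fun _ => 1) g * 2 ^ d := by
  rw [MvPolynomial.eval_eq, MvPolynomial.eval_eq, Finset.sum_mul]
  refine Finset.sum_congr rfl fun m hm => ?_
  have h : m.degree = d := by
    rw [Finsupp.degree_eq_weight_one (R := ℕ)]
    exact hg (MvPolynomial.mem_support_iff.1 hm)
  rw [Finset.prod_pow_eq_pow_sum, ← h, Finsupp.degree_apply]
  simp

theorem degreePrep_spec {n d : ℕ} (C : ArithCircuit n) {W : ℕ} {s : State} (hn : n + 3 ≤ W)
    (hs : C.size + 3 ≤ W) (hd : C.poly.IsHomogeneous d) (h : EvalInv C C.size s) :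
    Triple W degreePrep s 5 (DegreeInv C d (MvPolynomial.eval (fun _ => 1) C.poly) 0) := by
  obtain ⟨hI, h12, ha3, hq1, hq2, h4, h5⟩ := h
  have hI' := hI
  obtain ⟨⟨w0, w1, w2, w3, w4, w5⟩, ⟨q0, q1, q2⟩, ⟨a0, a1, a2⟩, b0⟩ := hI
  have := C.out.isLt
  have hW1 : 1 ≤ W := by omega
  have hW2 : n ≤ W := by omega
  have hW3 : n + 1 ≤ W := by omega
  have hW4 : (C.out : ℕ) ≤ W := by omega
  refine Triple.of_wp ?_ (by decide)
  simp [degreePrep, block, Prog.wp, Instr.Fits, Instr.run, WOp.eval, w0, w2, w3, w5, hW1, hW2, hW3,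
    hW4, DegreeInv, hI', ha3, hq1, hq2, h4 _ C.out.isLt C.out.isLt, h5 _ C.out.isLt C.out.isLt]
  exact ⟨rfl, eval_two_eq hd⟩

theorem degreeStep_spec {n d : ℕ} (C : ArithCircuit n) {u : ℚ} (hu : u ≠ 0) {W t : ℕ} {s : State}
    (hn : n + 3 ≤ W) (ht : t < n + 1) (h : DegreeInv C d u t s) :
    Triple W degreeStep s 5 (DegreeInv C d u (t + 1)) := by
  obtain ⟨hI, h12, h13, h6, h20, h21, ha3, hq1, hq2⟩ := h
  have hI' := hI
  obtain ⟨⟨w0, w1, w2, w3, w4, w5⟩, ⟨q0, q1, q2⟩, -, -⟩ := hI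
  have hW1 : 1 ≤ W := by omega
  have hW2 : t ≤ W := by omega
  have hW3 : t + 1 ≤ W := by omega
  -- As u = g(1,…,1) is nonzero, exactly one exponent passes the test.
  have hz : u * 2 ^ t - u * 2 ^ d = 0 ↔ d = t := by
    rw [sub_eq_zero, mul_right_inj' hu]
    refine ⟨fun h => (Nat.pow_right_injective le_rfl (by exact_mod_cast h)).symm, fun h => by rw [h]⟩
  refine Triple.of_wp ?_ (by decide)
  simp [degreeStep, block, Prog.wp, Instr.Fits, Instr.run, WOp.eval, QOp.eval, Test.Holds, w3, w5,
    hW1, hW2, hW3, DegreeInv, hI', ha3, hq1, hq2, h12, h13, h20, h21, hz]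
  constructor
  · intro h
    rw [if_pos (by omega)]
    exact ⟨h.symm, by ring⟩
  · intro h
    rw [h6]
    refine ⟨?_, by ring⟩
    congr 1
    exact propext ⟨fun _ => by omega, fun _ => by omega⟩

/-- The value n + 1 in `w₆` stands for "no degree found": it survives the loop exactly when d > n.
-/
theorem degreeLoop_spec {n d : ℕ} (C : ArithCircuit n) {u : ℚ} (hu : u ≠ 0) {W : ℕ} {s : State}
    (hn : n + 3 ≤ W) (h : DegreeInv C d u 0 s) :
    Triple W (.loop (.wlt 12 13) degreeStep) s ((n + 1) * 6 + 1) (DegreeInv C d u (n + 1)) := by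
  refine Triple.loop (n + 1) 5 (DegreeInv C d u) h
    (fun t ht s' h' => ⟨?_, degreeStep_spec C hu hn ht h'⟩) (fun s' h' => ?_) le_rfl
  · simp only [Test.Holds, h'.2.1, h'.2.2.1, ht]
  · simp only [Test.Holds, h'.2.1, h'.2.2.1, lt_irrefl, not_false_iff]

end RAM

/-! ### Construction of the list of masks -/

namespace RAM

theorem fib_succ_le_two_pow (k : ℕ) : Nat.fib (k + 1) ≤ 2 ^ k := by
  induction k with
  | zero => simp
  | succ k ih =>
    have h : Nat.fib k ≤ Nat.fib (k + 1) := Nat.fib_mono (Nat.le_succ k)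
    rw [Nat.fib_add_two, pow_succ]
    omega

theorem maskAt_lt {k i : ℕ} (hi : i < Nat.fib k) : maskAt k i < 2 ^ k :=
  (lt_two_pow_maskSize _).trans_le (Nat.pow_le_pow_right two_pos (maskSize_maskAt hi).le)

/-- Start with the empty list and the list of the empty mask. -/
def listPrep : Prog :=
  block [.wop .add 7 6 6, .wop .add 8 5 5, .wop .add 9 5 5, .wop .add 10 3 5, .wop .add 12 5 5,
    .wop .add 11 3 5]

/-- Append to the lists the mask that arises from the one at `w₂₁` by adding a lowest digit. -/
def listEntry : Prog :=
  .seq (block [.wload 22 3 21, .wop .mul 22 22 4]) <|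
  .seq (.ite (.wlt 21 9) (block [.wop .add 22 22 3]) .skip) <|
  block [.wop .add 23 21 20, .wstore 3 23 22, .wop .add 21 21 3]

/-- Append a new list, made of the last two lists. -/
def listStep : Prog :=
  .seq (block [.wop .sub 20 10 8, .wop .add 21 8 5]) <|
  .seq (.loop (.wlt 21 10) listEntry) <|
  block [.wop .add 8 9 5, .wop .add 9 10 5, .wop .add 10 10 20, .wop .add 11 11 11,
    .wop .add 12 12 3]

/-- The unchanging part of the memory during the construction of the lists of masks. -/
def ListBase {n : ℕ} (C : ArithCircuit n) (d t : ℕ) (s : State) : Prop :=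
  InputMem C s ∧ s.wreg 6 = d ∧ s.wreg 7 = 2 * d ∧ s.wreg 8 + 1 = Nat.fib (t + 1) ∧
  s.wreg 9 + 1 = Nat.fib (t + 2) ∧ s.wreg 10 + 1 = Nat.fib (t + 3) ∧ s.wreg 11 = 2 ^ t ∧
  s.wreg 12 = t ∧ s.qarr 1 = (fun _ => 0) ∧ s.qarr 2 = (fun _ => 0) ∧
  (∀ i < Nat.fib t, s.warr 3 (s.wreg 8 + i) = maskAt t i) ∧
  ∀ i < Nat.fib (t + 1), s.warr 3 (s.wreg 9 + i) = maskAt (t + 1) i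

/-- The first `r` entries of the new list are made. -/
def EntryInv {n : ℕ} (C : ArithCircuit n) (d t r : ℕ) (s : State) : Prop :=
  ListBase C d t s ∧ s.wreg 20 = Nat.fib (t + 2) ∧ s.wreg 21 = s.wreg 8 + r ∧
  ∀ i < r, s.warr 3 (s.wreg 10 + i) = maskAt (t + 2) i

/-- The two preceding lists are adjacent in memory, so one pointer runs through both. It is below
`w₉` exactly in the shorter list, whose masks receive the lowest digit one; each new mask is stored
F(t+2) cells further on. -/
theorem listEntry_spec {n d t r : ℕ} (C : ArithCircuit n) {W : ℕ} {s : State}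
    (hW : 8 * 2 ^ (2 * d) ≤ W) (ht : t < 2 * d) (hr : r < Nat.fib (t + 2))
    (h : EntryInv C d t r s) :
    s.wreg 21 < s.wreg 10 ∧ Triple W listEntry s 7 (EntryInv C d t (r + 1)) := by
  obtain ⟨⟨hI, h6, h7, h8, h9, h10, h11, h12, hq1, hq2, hl, hl'⟩, h20, h21, hn⟩ := h
  have hI' := hI
  obtain ⟨⟨w0, w1, w2, w3, w4, w5⟩, -, -, -⟩ := hI
  have f2 : Nat.fib (t + 2) = Nat.fib t + Nat.fib (t + 1) := Nat.fib_add_two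
  have f3 : Nat.fib (t + 3) = Nat.fib (t + 1) + Nat.fib (t + 2) := Nat.fib_add_two
  have f4 : Nat.fib (t + 4) = Nat.fib (t + 2) + Nat.fib (t + 3) := Nat.fib_add_two
  have hf : Nat.fib (t + 4) ≤ 2 ^ (t + 3) := fib_succ_le_two_pow _
  have hp : 2 ^ (t + 1) ≤ 2 ^ (2 * d) := Nat.pow_le_pow_right two_pos ht
  have hp1 : 2 ^ (t + 1) = 2 * 2 ^ t := by ring
  have hp3 : 2 ^ (t + 3) = 8 * 2 ^ t := by ring
  have hlt : s.wreg 8 + r < s.wreg 10 := by omega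
  refine ⟨by rw [h21]; exact hlt, ?_⟩
  obtain ⟨m, hm, hmW, hnew⟩ : ∃ m, s.warr 3 (s.wreg 8 + r) = m ∧ 2 * m + 1 ≤ W ∧
      maskAt (t + 2) r = m * 2 + if s.wreg 8 + r < s.wreg 9 then 1 else 0 := by
    refine ⟨_, rfl, ?_⟩
    by_cases hrt : r < Nat.fib t
    · have := maskAt_lt hrt
      rw [hl r hrt, maskAt_lt_fib hrt, if_pos (by omega)]
      omega
    · obtain ⟨i, rfl⟩ := Nat.exists_eq_add_of_le (Nat.le_of_not_lt hrt)
      have hi : i < Nat.fib (t + 1) := by omega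
      have := maskAt_lt hi
      rw [show s.wreg 8 + (Nat.fib t + i) = s.wreg 9 + i by omega, hl' i hi, maskAt_fib_add hi,
        if_neg (by omega)]
      omega
  have key : ∀ s' : State, InputMem C s' → s'.qarr = s.qarr → (∀ a ≤ 20, s'.wreg a = s.wreg a) →
      s'.wreg 21 = s.wreg 8 + r + 1 → s'.warr 3 = Function.update (s.warr 3)
        (s.wreg 8 + r + Nat.fib (t + 2)) (maskAt (t + 2) r) → EntryInv C d t (r + 1) s' := by
    intro s' i1 i2 i3 i4 i5
    refine ⟨⟨i1, ?_⟩, ?_⟩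
    · simp only [i2, i3, i5, h6, h7, h8, h9, h10, h11, h12, hq1, hq2, Nat.reduceLeDiff, true_and]
      constructor
      · intro i hi
        rw [Function.update_of_ne (by omega), hl i hi]
      · intro i hi
        rw [Function.update_of_ne (by omega), hl' i hi]
    · simp only [i3, i4, i5, h20, add_assoc, Nat.reduceLeDiff, true_and]
      intro i hi
      by_cases hir : i = r
      · rw [hir, show s.wreg 10 + r = s.wreg 8 + (r + Nat.fib (t + 2)) by omega,
          Function.update_self]
      · rw [Function.update_of_ne (by omega), hn i (by omega)]
  refine Triple.of_wp ?_ (by decide)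
  have b1 : s.wreg 8 + r ≤ W := by omega
  have b2 : s.wreg 8 + r + Nat.fib (t + 2) ≤ W := by omega
  have b3 : m ≤ W := by omega
  have b4 : m * 2 ≤ W := by omega
  have b5 : m * 2 + 1 ≤ W := by omega
  have b6 : 2 ≤ W := by omega
  have b7 : 1 ≤ W := by omega
  have b8 : s.wreg 8 + r + 1 ≤ W := by omega
  have b9 : Nat.fib (t + 2) ≤ W := by omega
  by_cases hc : s.wreg 8 + r < s.wreg 9
  · rw [if_pos hc] at hnew
    simp [listEntry, block, Prog.wp, Instr.Fits, Instr.run, WOp.eval, Test.Holds, w3, w4, h20, h21,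
      hm, hc, b1, b2, b3, b4, b5, b6, b7, b8, b9]
    refine key _ (by simp [hI']) rfl (fun a ha => ?_) (by simp) (by simp [hnew])
    simp [show a ≠ 21 by omega, show a ≠ 22 by omega, show a ≠ 23 by omega]
  · rw [if_neg hc] at hnew
    simp [listEntry, block, Prog.wp, Instr.Fits, Instr.run, WOp.eval, Test.Holds, w3, w4, h20, h21,
      hm, hc, b1, b2, b3, b4, b6, b7, b8, b9]
    refine key _ (by simp [hI']) rfl (fun a ha => ?_) (by simp) (by simp [hnew])
    simp [show a ≠ 21 by omega, show a ≠ 22 by omega, show a ≠ 23 by omega]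

theorem listStep_spec {n d t : ℕ} (C : ArithCircuit n) {W : ℕ} {s : State}
    (hW : 8 * 2 ^ (2 * d) ≤ W) (ht : t < 2 * d) (h : ListBase C d t s) :
    Triple W listStep s (8 * Nat.fib (2 * d + 1) + 8) (ListBase C d (t + 1)) := by
  have h' := h
  obtain ⟨hI, h6, h7, h8, h9, h10, h11, h12, hq1, hq2, hl, hl'⟩ := h
  have hI' := hI
  obtain ⟨⟨w0, w1, w2, w3, w4, w5⟩, -, -, -⟩ := hI
  have f2 : Nat.fib (t + 2) = Nat.fib t + Nat.fib (t + 1) := Nat.fib_add_two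
  have f3 : Nat.fib (t + 3) = Nat.fib (t + 1) + Nat.fib (t + 2) := Nat.fib_add_two
  have f4 : Nat.fib (t + 4) = Nat.fib (t + 2) + Nat.fib (t + 3) := Nat.fib_add_two
  have hf : Nat.fib (t + 4) ≤ 2 ^ (t + 3) := fib_succ_le_two_pow _
  have hp : 2 ^ (t + 1) ≤ 2 ^ (2 * d) := Nat.pow_le_pow_right two_pos ht
  have hp1 : 2 ^ (t + 1) = 2 * 2 ^ t := by ring
  have hp3 : 2 ^ (t + 3) = 8 * 2 ^ t := by ring
  have ht1 : t < 2 ^ t := Nat.lt_two_pow_self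
  have hm : Nat.fib (t + 2) ≤ Nat.fib (2 * d + 1) := Nat.fib_mono (by omega)
  have b1 : s.wreg 8 ≤ W := by omega
  have b2 : s.wreg 10 ≤ W := by omega
  have b3 : s.wreg 10 - s.wreg 8 ≤ W := by omega
  have b4 : s.wreg 10 - s.wreg 8 = Nat.fib (t + 2) := by omega
  refine Triple.of_wp_seq (T₁ := Nat.fib (t + 2) * 8 + 1 + 5) ?_ (by
    simp only [block, Prog.cost]; omega)
  simp [block, Prog.wp, Instr.Fits, Instr.run, WOp.eval, w5, b1, b2]
  simp only [b4]
  refine ⟨by omega, ?_⟩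
  refine Triple.seq (T₂ := 5) (Triple.loop (Nat.fib (t + 2)) 7 (EntryInv C d t) ?_
    (fun r hr s' hs' => listEntry_spec C hW ht hr hs') (fun s' hs' => ?_) le_rfl) ?_ le_rfl
  · simp [EntryInv, ListBase, hI', h6, h7, h8, h9, h10, h11, h12, hq1, hq2]
    exact ⟨hl, hl'⟩
  · obtain ⟨⟨-, -, -, i8, i9, i10, -⟩, -, i21, -⟩ := hs'
    simp only [Test.Holds, i21]
    omega
  · rintro s' ⟨⟨i1, i6, i7, i8, i9, i10, i11, i12, iq1, iq2, il, il'⟩, i20, i21, i3⟩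
    have i1' := i1
    obtain ⟨⟨-, -, -, w3, w4, w5⟩, -, -, -⟩ := i1
    have c1 : s'.wreg 9 ≤ W := by omega
    have c2 : s'.wreg 10 ≤ W := by omega
    have c3 : Nat.fib (t + 2) ≤ W := by omega
    have c4 : s'.wreg 10 + Nat.fib (t + 2) ≤ W := by omega
    have c5 : 2 ^ t ≤ W := by omega
    have c6 : 2 ^ t + 2 ^ t ≤ W := by omega
    have c7 : t + 1 ≤ W := by omega
    have c8 : t ≤ W := by omega
    have c9 : 1 ≤ W := by omega
    refine Triple.of_wp ?_ (by decide)
    simp [Prog.wp, Instr.Fits, Instr.run, WOp.eval, w3, w5, i11, i12, i20, c1, c2, c3, c4,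
      c5, c6, c7, c8, c9, ListBase, i1', i6, i7, i9, i10, iq1, iq2]
    exact ⟨by rw [show t + 1 + 3 = t + 4 by omega]; omega, by omega, il', i3⟩

/-- Nothing needs to be written: list 0 is empty, and list 1 consists of the mask 0, which is the
initial content of cell 0. -/
theorem listPrep_spec {n d : ℕ} (C : ArithCircuit n) {W : ℕ} {u : ℚ} {s : State}
    (hW : 8 * 2 ^ (2 * d) ≤ W) (hd : d < n + 1) (h : DegreeInv C d u (n + 1) s) :
    Triple W listPrep s 6 (ListBase C d 0) := by
  obtain ⟨hI, h12, h13, h6, h20, h21, ha3, hq1, hq2⟩ := h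
  have hI' := hI
  obtain ⟨⟨w0, w1, w2, w3, w4, w5⟩, -, -, -⟩ := hI
  rw [if_pos hd] at h6
  have : 2 * d < 2 ^ (2 * d) := Nat.lt_two_pow_self
  have b1 : d ≤ W := by omega
  have b2 : d + d ≤ W := by omega
  have b3 : 1 ≤ W := by omega
  refine Triple.of_wp ?_ (by decide)
  simp [listPrep, block, Prog.wp, Instr.Fits, Instr.run, WOp.eval, w3, w5, h6, b1, b2, b3,
    ListBase, hI', hq1, hq2, ha3, two_mul]
  refine ⟨by decide, rfl⟩

theorem listLoop_spec {n d : ℕ} (C : ArithCircuit n) {W : ℕ} {s : State}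
    (hW : 8 * 2 ^ (2 * d) ≤ W) (h : ListBase C d 0 s) :
    Triple W (.loop (.wlt 12 7) listStep) s (2 * d * (8 * Nat.fib (2 * d + 1) + 9) + 1)
      (ListBase C d (2 * d)) := by
  refine Triple.loop (2 * d) _ (ListBase C d) h
    (fun t ht s' h' => ⟨?_, listStep_spec C hW ht h'⟩) (fun s' h' => ?_) le_rfl
  all_goals obtain ⟨-, -, h7, -, -, -, -, h12, -⟩ := h'
  · simp only [Test.Holds, h7, h12, ht]
  · simp only [Test.Holds, h7, h12, lt_irrefl, not_false_iff]

end RAM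

/-! ### Coordinate vectors in memory -/

namespace RAM

/-- The memory after the construction of the list of masks. -/
def MainMem {n : ℕ} (C : ArithCircuit n) (d : ℕ) (s : State) : Prop :=
  InputMem C s ∧ s.wreg 7 = 2 * d ∧ s.wreg 10 = s.wreg 9 + Nat.fib (2 * d + 1) ∧
  s.wreg 10 ≤ 4 * 2 ^ (2 * d) ∧ s.wreg 11 = 2 ^ (2 * d) ∧
  ∀ i < Nat.fib (2 * d + 1), s.warr 3 (s.wreg 9 + i) = maskAt (2 * d + 1) i

section MainMem

variable {n d : ℕ} {C : ArithCircuit n} {s : State} {r A i v : ℕ} {q : ℚ}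

@[simp] theorem mainMem_setW (h : 12 ≤ r) : MainMem C d (s.setW r v) ↔ MainMem C d s := by
  have h0 : 7 ≠ r := by omega
  have h1 : 9 ≠ r := by omega
  have h2 : 10 ≠ r := by omega
  have h3 : 11 ≠ r := by omega
  have h4 : 6 ≤ r := by omega
  simp [MainMem, h0, h1, h2, h3, h4]

@[simp] theorem mainMem_setQ (h : 3 ≤ r) : MainMem C d (s.setQ r q) ↔ MainMem C d s := by
  simp [MainMem, h]

@[simp] theorem mainMem_setQArr (h : 1 ≤ A) : MainMem C d (s.setQArr A i q) ↔ MainMem C d s := by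
  simp [MainMem, h]

end MainMem

/-- The word bound is large enough for all the addresses. -/
def WordBound {n : ℕ} (C : ArithCircuit n) (d W : ℕ) : Prop :=
  n + 3 ≤ W ∧ C.size + 3 ≤ W ∧ 8 * (C.size + 1) * 2 ^ (2 * d) ≤ W

theorem WordBound.addr {n d W : ℕ} {C : ArithCircuit n} (h : WordBound C d W) {k J : ℕ}
    (hk : k ≤ C.size) (hJ : J < 8 * 2 ^ (2 * d)) : k * 2 ^ (2 * d) + J ≤ W := by
  have h1 : k * 2 ^ (2 * d) ≤ C.size * 2 ^ (2 * d) := Nat.mul_le_mul_right _ hk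
  have h2 := h.2.2
  have h3 : 8 * (C.size + 1) * 2 ^ (2 * d) = 8 * (C.size * 2 ^ (2 * d)) + 8 * 2 ^ (2 * d) := by ring
  omega

theorem WordBound.base {n d W : ℕ} {C : ArithCircuit n} (h : WordBound C d W) {k : ℕ}
    (hk : k ≤ C.size) : k * 2 ^ (2 * d) ≤ W :=
  h.addr (J := 0) hk (by positivity)

/-- The factor 8 leaves room for the addresses in the lists of masks, which are bounded through
F(t+4) ≤ 8 · 2^t. -/
theorem WordBound.small {n d W : ℕ} {C : ArithCircuit n} (h : WordBound C d W) :
    8 * 2 ^ (2 * d) ≤ W := by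
  refine le_trans ?_ h.2.2
  exact Nat.mul_le_mul_right _ (by omega)

theorem block_addr_ne {X k k' J J' : ℕ} (hk : k ≠ k') (hJ : J < X) (hJ' : J' < X) :
    k * X + J ≠ k' * X + J' := by
  intro h
  apply hk
  have h1 : (k * X + J) / X = k := by
    rw [mul_comm, Nat.mul_add_div (by omega), Nat.div_eq_of_lt hJ, add_zero]
  have h2 : (k' * X + J') / X = k' := by
    rw [mul_comm, Nat.mul_add_div (by omega), Nat.div_eq_of_lt hJ', add_zero]
  rw [← h1, h, h2]

/-- The first `t` coordinates in block `k` agree with `f`, and the other blocks with `q₀`. -/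
def Stored (d k : ℕ) (q₀ f : ℕ → ℚ) (t : ℕ) (q : ℕ → ℚ) : Prop :=
  (∀ i < t, q (k * 2 ^ (2 * d) + maskAt (2 * d + 1) i) = f (maskAt (2 * d + 1) i)) ∧
  ∀ k' ≠ k, ∀ J < 2 ^ (2 * d), q (k' * 2 ^ (2 * d) + J) = q₀ (k' * 2 ^ (2 * d) + J)

theorem Stored.zero (d k : ℕ) (q₀ f : ℕ → ℚ) : Stored d k q₀ f 0 q₀ :=
  ⟨fun _ h => absurd h (Nat.not_lt_zero _), fun _ _ _ _ => rfl⟩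

theorem Stored.update {d k t : ℕ} {q₀ f q : ℕ → ℚ} (h : Stored d k q₀ f t q)
    (ht : t < Nat.fib (2 * d + 1)) : Stored d k q₀ f (t + 1)
      (Function.update q (k * 2 ^ (2 * d) + maskAt (2 * d + 1) t) (f (maskAt (2 * d + 1) t))) := by
  refine ⟨fun i hi => ?_, fun k' hk' J hJ => ?_⟩
  · rcases Nat.lt_succ_iff_lt_or_eq.1 hi with hi | rfl
    · rw [Function.update_of_ne, h.1 i hi]
      intro he
      exact hi.ne (maskAt_injOn (hi.trans ht) ht (Nat.add_left_cancel he))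
    · rw [Function.update_self]
  · rw [Function.update_of_ne (block_addr_ne hk' hJ (maskAt_lt_two_pow ht)), h.2 k' hk' J hJ]

/-- The vector in block `k`. -/
def vecAt (d : ℕ) (s : State) (k J : ℕ) : ℚ := s.qarr 1 (k * 2 ^ (2 * d) + J)

/-- The state after the vector `f` has been computed in block `k`: the other blocks and the
counter of gates are as in `s`, and the workspace is clean. -/
def VecComputed {n : ℕ} (C : ArithCircuit n) (d k : ℕ) (s : State) (f : ℕ → ℚ) (s' : State) :
    Prop :=
  MainMem C d s' ∧ s'.wreg 12 = s.wreg 12 ∧ s'.qarr 2 = (fun _ => 0) ∧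
  Stored d k (s.qarr 1) f (Nat.fib (2 * d + 1)) (s'.qarr 1)

/-- Store in block `w₁₄` the vector in block `w₁₃` times `q₂₀`. -/
def scaleStep : Prog :=
  block [.wload 25 3 24, .wop .add 26 13 25, .qload 10 1 26, .qop .mul 10 20 10,
    .wop .add 26 14 25, .qstore 1 26 10, .wop .add 24 24 3]

def scaleProg : Prog := .seq (block [.wop .add 24 9 5]) (.loop (.wlt 24 10) scaleStep)

/-- Store in block `w₁₄` the sum of the vectors in the blocks `w₂₁` and `w₂₂`. -/
def addStep : Prog :=
  block [.wload 25 3 24, .wop .add 26 21 25, .qload 10 1 26, .wop .add 26 22 25, .qload 11 1 26,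
    .qop .add 10 10 11, .wop .add 26 14 25, .qstore 1 26 10, .wop .add 24 24 3]

def addProg : Prog := .seq (block [.wop .add 24 9 5]) (.loop (.wlt 24 10) addStep)

section Specs

variable {n d W : ℕ} {C : ArithCircuit n} {s : State}

theorem scaleProg_spec (hW : WordBound C d W) (hs : MainMem C d s) {a k : ℕ} (ha : a ≤ C.size)
    (hk : k ≤ C.size) (hak : a ≠ k) (h13 : s.wreg 13 = a * 2 ^ (2 * d))
    (h14 : s.wreg 14 = k * 2 ^ (2 * d)) (hq2 : s.qarr 2 = fun _ => 0) :
    Triple W scaleProg s (8 * Nat.fib (2 * d + 1) + 2)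
      (VecComputed C d k s fun J => s.qreg 20 * vecAt d s a J) := by
  have hw := hs
  obtain ⟨⟨⟨-, -, -, -, -, w5⟩, -, -, -⟩, -, w10, w10', w11, -⟩ := hs
  have hsm := hW.small
  have b9 : s.wreg 9 ≤ W := by omega
  refine Triple.of_wp_seq (T₁ := 8 * Nat.fib (2 * d + 1) + 1) ?_
    (by simp only [block, Prog.cost]; omega)
  simp [block, Prog.wp, Instr.Fits, Instr.run, WOp.eval, w5, b9]
  let I : ℕ → State → Prop := fun t s' => (MainMem C d s' ∧ s'.wreg 12 = s.wreg 12 ∧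
    s'.qarr 2 = (fun _ => 0) ∧ Stored d k (s.qarr 1) (fun J => s.qreg 20 * vecAt d s a J) t
      (s'.qarr 1)) ∧ s'.wreg 13 = a * 2 ^ (2 * d) ∧ s'.wreg 14 = k * 2 ^ (2 * d) ∧
    s'.wreg 24 = s'.wreg 9 + t ∧ s'.qreg 20 = s.qreg 20
  refine (Triple.loop (Nat.fib (2 * d + 1)) 7 I ?_ ?_ ?_ le_rfl).mono (by omega) fun s' h => h.1
  · simp [I, hw, hq2, h13, h14, Stored.zero]
  · rintro t ht s' ⟨⟨iM, i12, iq2, iS⟩, i13, i14, i24, i20⟩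
    have iM' := iM
    obtain ⟨⟨⟨-, -, -, w3, -, w5⟩, -, -, -⟩, -, w10, w10', w11, wl⟩ := iM
    have hJ := maskAt_lt_two_pow ht
    have b1 := hW.addr ha (hJ.trans_le (by omega))
    have b2 := hW.addr hk (hJ.trans_le (by omega))
    have b3 := hW.base ha
    have b4 := hW.base hk
    have b5 : maskAt (2 * d + 1) t ≤ W := by omega
    have b6 : s'.wreg 9 + t ≤ W := by omega
    have b7 : s'.wreg 9 + t + 1 ≤ W := by omega
    have b8 : 1 ≤ W := by omega
    refine ⟨by simp only [Test.Holds, i24]; omega, Triple.of_wp ?_ (by decide)⟩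
    simp [scaleStep, block, Prog.wp, Instr.Fits, Instr.run, WOp.eval, QOp.eval, w3, i13, i14, i24,
      wl t ht, b1, b2, b3, b4, b5, b6, b7, b8]
    simp only [I]
    simp [iM', i12, iq2, i13, i14, i20, add_assoc]
    have := iS.update ht
    simp only [vecAt] at this
    -- The source block is still the original one, because only block k is written.
    rwa [← iS.2 a hak _ hJ] at this
  · rintro s' ⟨⟨iM, -⟩, -, -, i24, -⟩
    obtain ⟨-, -, w10, -⟩ := iM
    simp only [Test.Holds, i24]
    omega

theorem addProg_spec (hW : WordBound C d W) (hs : MainMem C d s) {a b k : ℕ} (ha : a ≤ C.size)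
    (hb : b ≤ C.size) (hk : k ≤ C.size) (hak : a ≠ k) (hbk : b ≠ k)
    (h21 : s.wreg 21 = a * 2 ^ (2 * d)) (h22 : s.wreg 22 = b * 2 ^ (2 * d))
    (h14 : s.wreg 14 = k * 2 ^ (2 * d)) (hq2 : s.qarr 2 = fun _ => 0) :
    Triple W addProg s (10 * Nat.fib (2 * d + 1) + 2)
      (VecComputed C d k s fun J => vecAt d s a J + vecAt d s b J) := by
  have hw := hs
  obtain ⟨⟨⟨-, -, -, -, -, w5⟩, -, -, -⟩, -, w10, w10', w11, -⟩ := hs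
  have hsm := hW.small
  have b9 : s.wreg 9 ≤ W := by omega
  refine Triple.of_wp_seq (T₁ := 10 * Nat.fib (2 * d + 1) + 1) ?_
    (by simp only [block, Prog.cost]; omega)
  simp [block, Prog.wp, Instr.Fits, Instr.run, WOp.eval, w5, b9]
  let I : ℕ → State → Prop := fun t s' => (MainMem C d s' ∧ s'.wreg 12 = s.wreg 12 ∧
    s'.qarr 2 = (fun _ => 0) ∧ Stored d k (s.qarr 1) (fun J => vecAt d s a J + vecAt d s b J) t
      (s'.qarr 1)) ∧ s'.wreg 21 = a * 2 ^ (2 * d) ∧ s'.wreg 22 = b * 2 ^ (2 * d) ∧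
    s'.wreg 14 = k * 2 ^ (2 * d) ∧ s'.wreg 24 = s'.wreg 9 + t
  refine (Triple.loop (Nat.fib (2 * d + 1)) 9 I ?_ ?_ ?_ le_rfl).mono (by omega) fun s' h => h.1
  · simp [I, hw, hq2, h21, h22, h14, Stored.zero]
  · rintro t ht s' ⟨⟨iM, i12, iq2, iS⟩, i21, i22, i14, i24⟩
    have iM' := iM
    obtain ⟨⟨⟨-, -, -, w3, -, w5⟩, -, -, -⟩, -, w10, w10', w11, wl⟩ := iM
    have hJ := maskAt_lt_two_pow ht
    have b1 := hW.addr ha (hJ.trans_le (by omega))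
    have b2 := hW.addr hk (hJ.trans_le (by omega))
    have b0 := hW.addr hb (hJ.trans_le (by omega))
    have b3 := hW.base ha
    have b4 := hW.base hk
    have b9 := hW.base hb
    have b5 : maskAt (2 * d + 1) t ≤ W := by omega
    have b6 : s'.wreg 9 + t ≤ W := by omega
    have b7 : s'.wreg 9 + t + 1 ≤ W := by omega
    have b8 : 1 ≤ W := by omega
    refine ⟨by simp only [Test.Holds, i24]; omega, Triple.of_wp ?_ (by decide)⟩
    simp [addStep, block, Prog.wp, Instr.Fits, Instr.run, WOp.eval, QOp.eval, w3, i21, i22, i14,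
      i24, wl t ht, b0, b1, b2, b3, b4, b5, b6, b7, b8, b9]
    simp only [I]
    simp [iM', i12, iq2, i21, i22, i14, add_assoc]
    have := iS.update ht
    simp only [vecAt] at this
    rwa [← iS.2 a hak _ hJ, ← iS.2 b hbk _ hJ] at this
  · rintro s' ⟨⟨iM, -⟩, -, -, -, i24⟩
    obtain ⟨-, -, w10, -⟩ := iM
    simp only [Test.Holds, i24]
    omega

end Specs

end RAM

/-! ### The operators `apolarOp` on vectors in memory -/

namespace RAM

/-- Add the contribution of bit `w₂₇` of the mask `w₂₅` to the contraction. -/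
def contractBit : Prog :=
  .seq (block [.wop .div 29 25 28, .wop .mod 29 29 4]) <|
  .seq (.ite (.weq 29 3) (block [.wop .sub 30 25 28, .qload 11 2 30, .qop .add 11 11 10,
    .qstore 2 30 11, .qop .sub 10 0 10]) .skip) <|
  block [.qop .mul 10 10 20, .wop .add 28 28 28, .wop .add 27 27 3]

/-- Add the contribution of the mask at `w₂₄` to the contraction. -/
def contractStep : Prog :=
  .seq (block [.wload 25 3 24, .wop .add 26 13 25, .qload 10 1 26, .wop .add 27 5 5,
    .wop .add 28 3 5]) <|
  .seq (.loop (.wlt 27 7) contractBit) <|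
  block [.wop .add 24 24 3]

def contractProg : Prog := .seq (block [.wop .add 24 9 5]) (.loop (.wlt 24 10) contractStep)

/-- Replace `X ^ j` by `X ^ (j + 1) - α X ^ j` at the mask at `w₂₄`, where `w₂₈ = 2 ^ j`. -/
def raiseStep : Prog :=
  .seq (block [.wload 25 3 24, .wop .div 29 25 28, .wop .mod 29 29 4]) <|
  .seq (.ite (.weq 29 3)
    (.seq (block [.qload 10 2 25, .qop .mul 11 20 10, .qop .sub 11 0 11, .qstore 2 25 11,
      .wop .div 29 25 31, .wop .mod 29 29 4]) <|
    .ite (.weq 29 3) .skip (block [.wop .add 30 25 28, .qload 11 2 30, .qop .add 11 11 10,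
      .qstore 2 30 11])) .skip) <|
  block [.wop .add 24 24 3]

/-- Make the replacement at the next lower position. -/
def raisePass : Prog :=
  .seq (block [.wop .div 28 28 4, .wop .mul 31 28 4, .wop .add 24 9 5]) <|
  .seq (.loop (.wlt 24 10) raiseStep) <|
  block [.wop .add 27 27 3]

def raiseProg : Prog :=
  .seq (block [.wop .add 27 5 5, .wop .add 28 11 5]) (.loop (.wlt 27 7) raisePass)

/-- Move the workspace to block `w₁₄`. -/
def copyStep : Prog :=
  block [.wload 25 3 24, .qload 10 2 25, .wop .add 26 14 25, .qstore 1 26 10, .qstore 2 25 0,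
    .wop .add 24 24 3]

def copyProg : Prog := .seq (block [.wop .add 24 9 5]) (.loop (.wlt 24 10) copyStep)

/-- Set `q₂₀` to the index of the variable at gate `w₁₅`. -/
def alphaProg : Prog :=
  .seq (block [.wload 16 1 15, .qop .add 20 0 0, .wop .add 17 5 5])
    (.loop (.wlt 17 16) (block [.qop .add 20 20 1, .wop .add 17 17 3]))

theorem testBit_iff (J t : ℕ) : J.testBit t = true ↔ J / 2 ^ t % 2 = 1 := by
  rw [Nat.testBit_eq_decide_div_mod_eq, decide_eq_true_iff]

section Specs

variable {n d W : ℕ} {C : ArithCircuit n} {s : State}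

/-- The memory during the computation of `apolarOp α`, as compared to the initial state `s`. -/
def ApolarMem (C : ArithCircuit n) (d a k : ℕ) (α : ℚ) (s s' : State) : Prop :=
  MainMem C d s' ∧ s'.wreg 12 = s.wreg 12 ∧ s'.wreg 13 = a * 2 ^ (2 * d) ∧
  s'.wreg 14 = k * 2 ^ (2 * d) ∧ s'.qreg 20 = α ∧ s'.qarr 1 = s.qarr 1

@[simp] theorem apolarMem_setW {a k r v : ℕ} {α : ℚ} {s' : State} (h : 15 ≤ r) :
    ApolarMem C d a k α s (s'.setW r v) ↔ ApolarMem C d a k α s s' := by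
  have h0 : 12 ≠ r := by omega
  have h1 : 13 ≠ r := by omega
  have h2 : 14 ≠ r := by omega
  have h3 : 12 ≤ r := by omega
  simp [ApolarMem, h0, h1, h2, h3]

@[simp] theorem apolarMem_setQ {a k r : ℕ} {α v : ℚ} {s' : State} (h : 3 ≤ r) (h' : r < 20) :
    ApolarMem C d a k α s (s'.setQ r v) ↔ ApolarMem C d a k α s s' := by
  have h0 : 20 ≠ r := by omega
  simp [ApolarMem, h, h0]

@[simp] theorem apolarMem_setQArr {a k A i : ℕ} {α v : ℚ} {s' : State} (h : 2 ≤ A) :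
    ApolarMem C d a k α s (s'.setQArr A i v) ↔ ApolarMem C d a k α s s' := by
  have h0 : 1 ≠ A := by omega
  have h1 : 1 ≤ A := by omega
  simp [ApolarMem, h0, h1]

/-- The first `t` bits of the mask number `r` have been treated. -/
def ContractInv (C : ArithCircuit n) (d a k : ℕ) (α : ℚ) (s : State) (r t : ℕ) (s' : State) :
    Prop :=
  ApolarMem C d a k α s s' ∧ s'.wreg 24 = s'.wreg 9 + r ∧
  s'.wreg 25 = maskAt (2 * d + 1) r ∧ s'.wreg 27 = t ∧ s'.wreg 28 = 2 ^ t ∧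
  s'.qreg 10 = vecAt d s a (maskAt (2 * d + 1) r) *
    (maskSign (maskAt (2 * d + 1) r) t * α ^ t) ∧
  s'.qarr 2 = fun m => contractSum (2 * d) α (vecAt d s a) r m +
    vecAt d s a (maskAt (2 * d + 1) r) * contractTerm α (maskAt (2 * d + 1) r) t m

theorem contractTerm_succ_apply (α : ℚ) (J t m : ℕ) : contractTerm α J (t + 1) m =
    contractTerm α J t m +
      if J.testBit t = true ∧ m = J - 2 ^ t then maskSign J t * α ^ t else 0 := by
  rw [contractTerm, Finset.sum_range_succ, Finsupp.add_apply, ← contractTerm]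
  congr 1
  by_cases h : J.testBit t = true
  · by_cases hm : m = J - 2 ^ t
    · simp [h, hm]
    · rw [if_pos h, Finsupp.single_eq_of_ne hm, if_neg (by tauto)]
  · simp [h]

/-- Register `q₁₀` carries the coordinate times the signed power of α. It is negated after each bit
that is set and multiplied by α after every bit, so no power or parity is recomputed. -/
theorem contractBit_spec (hW : WordBound C d W) {a k r t : ℕ} {α : ℚ}
    (hr : r < Nat.fib (2 * d + 1)) (ht : t < 2 * d) {s' : State}
    (h : ContractInv C d a k α s r t s') :
    Triple W contractBit s' 11 (ContractInv C d a k α s r (t + 1)) := by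
  obtain ⟨iM, i24, i25, i27, i28, i10, iq2⟩ := h
  have iM' := iM
  obtain ⟨⟨⟨⟨-, -, -, w3, w4, w5⟩, ⟨q0, -, -⟩, -, -⟩, -, w10, w10', w11, wl⟩, -, -, -, i20, -⟩ := iM
  have hsm := hW.small
  have hJ := maskAt_lt_two_pow hr
  obtain ⟨J, hJd⟩ : ∃ J, maskAt (2 * d + 1) r = J := ⟨_, rfl⟩
  rw [hJd] at hJ i25 i10 iq2
  have hb := testBit_iff J t
  have hp : 2 ^ (t + 1) ≤ 2 ^ (2 * d) := Nat.pow_le_pow_right two_pos ht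
  have hp1 : 2 ^ (t + 1) = 2 ^ t + 2 ^ t := by ring
  have htt : t < 2 ^ t := Nat.lt_two_pow_self
  have b1 : J ≤ W := by omega
  have b2 : 2 ^ t ≤ W := by omega
  have b3 : J / 2 ^ t ≤ W := (Nat.div_le_self _ _).trans b1
  have b4 : J / 2 ^ t % 2 ≤ W := (Nat.mod_le _ _).trans b3
  have b5 : 2 ≤ W := by omega
  have b6 : J - 2 ^ t ≤ W := by omega
  have b7 : 2 ^ t + 2 ^ t ≤ W := by omega
  have b8 : t ≤ W := by omega
  have b9 : 1 ≤ W := by omega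
  have b10 : t + 1 ≤ W := by omega
  refine Triple.of_wp ?_ (by decide)
  by_cases hc : J / 2 ^ t % 2 = 1
  · simp [contractBit, block, Prog.wp, Instr.Fits, Instr.run, WOp.eval, QOp.eval, Test.Holds, w3,
      w4, q0, i25, i27, i28, i10, i20, iq2, hc, b1, b2, b3, b5, b6, b7, b8, b9, b10]
    simp only [ContractInv]
    simp [iM', i24, i25, hJd, hp1, maskSign, hb.2 hc, contractTerm_succ_apply, iq2]
    refine ⟨by ring, ?_⟩
    funext m
    rw [Function.update_apply]
    split_ifs with hm
    · rw [hm]; ring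
    · ring
  · simp [contractBit, block, Prog.wp, Instr.Fits, Instr.run, WOp.eval, QOp.eval, Test.Holds, w3,
      w4, i25, i27, i28, i10, i20, hc, b1, b2, b3, b4, b5, b7, b8, b9, b10]
    simp only [ContractInv]
    rw [← hb] at hc
    simp [iM', i24, i25, hJd, hp1, maskSign, hc, contractTerm_succ_apply, iq2]
    ring

theorem contractSum_succ_apply (N : ℕ) (α : ℚ) (c : ℕ → ℚ) (r m : ℕ) :
    contractSum N α c (r + 1) m = contractSum N α c r m +
      c (maskAt (N + 1) r) * contractTerm α (maskAt (N + 1) r) N m := by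
  rw [contractSum, Finset.sum_range_succ, Finsupp.add_apply, ← contractSum, Finsupp.smul_apply,
    smul_eq_mul]

theorem contractProg_spec (hW : WordBound C d W) {a k : ℕ} (ha : a ≤ C.size) {α : ℚ}
    (hM : ApolarMem C d a k α s s) (hq2 : s.qarr 2 = fun _ => 0) :
    Triple W contractProg s (Nat.fib (2 * d + 1) * (2 * d * 12 + 8) + 2) fun s' =>
      ApolarMem C d a k α s s' ∧
      s'.qarr 2 = contractSum (2 * d) α (vecAt d s a) (Nat.fib (2 * d + 1)) := by
  have hM' := hM
  obtain ⟨⟨⟨⟨-, -, -, w3, w4, w5⟩, -, -, -⟩, -, w10, w10', -, -⟩, -⟩ := hM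
  have hsm := hW.small
  have b9 : s.wreg 9 ≤ W := by omega
  refine Triple.of_wp_seq (T₁ := Nat.fib (2 * d + 1) * (2 * d * 12 + 8) + 1) ?_
    (by simp only [block, Prog.cost]; omega)
  simp [block, Prog.wp, Instr.Fits, Instr.run, WOp.eval, w5, b9]
  let I : ℕ → State → Prop := fun r s' => (ApolarMem C d a k α s s' ∧
    s'.qarr 2 = contractSum (2 * d) α (vecAt d s a) r) ∧ s'.wreg 24 = s'.wreg 9 + r
  refine (Triple.loop (Nat.fib (2 * d + 1)) (2 * d * 12 + 7) I ?_ ?_ ?_ le_rfl).mono le_rfl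
    fun s' h => h.1
  · simp [I, hM', hq2, contractSum]
    rfl
  · rintro r hr s' ⟨⟨iM, iq2⟩, i24⟩
    have iM' := iM
    obtain ⟨⟨⟨⟨-, -, -, w3, w4, w5⟩, -, -, -⟩, w7, w10, w10', w11, wl⟩, -, i13, -, i20, iq1⟩ := iM
    refine ⟨by simp only [Test.Holds, i24]; omega, ?_⟩
    have hJ := maskAt_lt_two_pow hr
    have b1 := hW.addr ha (hJ.trans_le (by omega))
    have b3 := hW.base ha
    have b5 : maskAt (2 * d + 1) r ≤ W := by omega
    have b6 : s'.wreg 9 + r ≤ W := by omega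
    have b8 : 1 ≤ W := by omega
    refine Triple.of_wp_seq (T₁ := 2 * d * 12 + 1 + 1) ?_ (by simp only [block, Prog.cost]; omega)
    simp [block, Prog.wp, Instr.Fits, Instr.run, WOp.eval, w3, w5, i13, i24, iq1,
      wl r hr, b1, b3, b5, b6, b8]
    refine Triple.seq (T₂ := 1) (Triple.loop (2 * d) 11 (ContractInv C d a k α s r) ?_
      (fun t ht s'' h => ⟨?_, contractBit_spec hW hr ht h⟩) ?_ le_rfl) ?_ le_rfl
    · simp [ContractInv, iM', i24, maskSign, contractTerm, iq2, vecAt]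
    · obtain ⟨⟨⟨-, w7, -⟩, -⟩, -, -, i27, -⟩ := h
      simp only [Test.Holds, i27, w7, ht]
    · rintro s'' ⟨⟨⟨-, w7, -⟩, -⟩, -, -, i27, -⟩
      simp only [Test.Holds, i27, w7, lt_irrefl, not_false_iff]
    · rintro s'' ⟨iM, i24, -, -, -, -, iq2⟩
      have iM' := iM
      obtain ⟨⟨⟨⟨-, -, -, w3, w4, w5⟩, -, -, -⟩, w7, w10, w10', w11, wl⟩, -⟩ := iM
      have b6 : s''.wreg 9 + r ≤ W := by omega
      have b7 : s''.wreg 9 + r + 1 ≤ W := by omega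
      refine Triple.of_wp ?_ (by decide)
      simp [Prog.wp, Instr.Fits, Instr.run, WOp.eval, w3, i24, b6, b7, b8]
      simp only [I]
      simp [iM', iq2, add_assoc]
      funext m
      rw [contractSum_succ_apply]
  · rintro s' ⟨⟨⟨⟨-, -, w10, -⟩, -⟩, -⟩, i24⟩
    simp only [Test.Holds, i24]
    omega

/-- The replacement at position `j = 2 * d - 1 - t` has been made at the first `r` masks. -/
def RaiseInv (C : ArithCircuit n) (d a k : ℕ) (α : ℚ) (s : State) (c : ℕ →₀ ℚ) (t r : ℕ)
    (s' : State) : Prop :=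
  ApolarMem C d a k α s s' ∧ s'.wreg 24 = s'.wreg 9 + r ∧ s'.wreg 27 = t ∧
  s'.wreg 28 = 2 ^ (2 * d - 1 - t) ∧ s'.wreg 31 = 2 ^ (2 * d - 1 - t + 1) ∧
  s'.qarr 2 = raiseSum (2 * d) α (2 * d - 1 - t) c r

theorem raiseSum_succ_apply (N : ℕ) (α : ℚ) (j : ℕ) (c : ℕ →₀ ℚ) (r m : ℕ) :
    raiseSum N α j c (r + 1) m = raiseSum N α j c r m +
      c (maskAt (N + 1) r) * raiseTerm α j (maskAt (N + 1) r) m := by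
  rw [raiseSum, Finset.sum_range_succ, ← add_assoc, Finsupp.add_apply, ← raiseSum,
    Finsupp.smul_apply, smul_eq_mul]

theorem raiseStep_spec (hW : WordBound C d W) {a k r t : ℕ} {α : ℚ} {c : ℕ →₀ ℚ}
    (hr : r < Nat.fib (2 * d + 1)) (ht : t < 2 * d) {s' : State}
    (h : RaiseInv C d a k α s c t r s') :
    s'.wreg 24 < s'.wreg 10 ∧ Triple W raiseStep s' 16 (RaiseInv C d a k α s c t (r + 1)) := by
  obtain ⟨iM, i24, i27, i28, i31, iq2⟩ := h
  have iM' := iM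
  obtain ⟨⟨⟨⟨-, -, -, w3, w4, w5⟩, ⟨q0, -, -⟩, -, -⟩, -, w10, w10', w11, wl⟩, -, -, -, i20, -⟩ := iM
  refine ⟨by omega, ?_⟩
  have hsm := hW.small
  have hJ := maskAt_lt_two_pow hr
  -- The machine reads a partially updated array, but a cell whose mask has bit j set still holds
  -- its value from before the pass.
  have hsum := raiseSum_apply_maskAt (α := α) (j := 2 * d - 1 - t) (c := c) hr
  have hwl := wl r hr
  have hs := raiseSum_succ_apply (2 * d) α (2 * d - 1 - t) c r
  obtain ⟨J, hJd⟩ : ∃ J, maskAt (2 * d + 1) r = J := ⟨_, rfl⟩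
  obtain ⟨j, hjd⟩ : ∃ j, 2 * d - 1 - t = j := ⟨_, rfl⟩
  have hj : j < 2 * d := by omega
  rw [hJd] at hJ hsum hwl
  rw [hjd] at hsum i28 i31 iq2
  rw [hJd, hjd] at hs
  have hp : 2 ^ (j + 1) ≤ 2 ^ (2 * d) := Nat.pow_le_pow_right two_pos hj
  have hp1 : 2 ^ (j + 1) = 2 ^ j + 2 ^ j := by ring
  have hp0 : 0 < 2 ^ j := by positivity
  have b1 : J ≤ W := by omega
  have b2 : 2 ^ j ≤ W := by omega
  have b3 : J / 2 ^ j ≤ W := (Nat.div_le_self _ _).trans b1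
  have b4 : J / 2 ^ j % 2 ≤ W := (Nat.mod_le _ _).trans b3
  have b5 : 2 ≤ W := by omega
  have b6 : J + 2 ^ j ≤ W := by omega
  have b7 : 2 ^ (j + 1) ≤ W := by omega
  have b8 : J / 2 ^ (j + 1) ≤ W := (Nat.div_le_self _ _).trans b1
  have b9 : J / 2 ^ (j + 1) % 2 ≤ W := (Nat.mod_le _ _).trans b8
  have b10 : 1 ≤ W := by omega
  have b11 : s'.wreg 9 + r ≤ W := by omega
  have b12 : s'.wreg 9 + r + 1 ≤ W := by omega
  have hc := testBit_iff J j
  have hc' := testBit_iff J (j + 1)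
  refine Triple.of_wp ?_ (by decide)
  by_cases h1 : J / 2 ^ j % 2 = 1
  · have hv := hsum (hc.2 h1)
    by_cases h2 : J / 2 ^ (j + 1) % 2 = 1
    · simp [raiseStep, block, Prog.wp, Instr.Fits, Instr.run, WOp.eval, QOp.eval, Test.Holds, w3,
        w4, q0, i20, i24, i28, i31, hwl, h1, h2, b1, b2, b3, b5, b7, b8, b10, b11, b12]
      simp only [RaiseInv]
      simp [iM', i27, i28, i31, hjd, add_assoc]
      funext m
      rw [iq2, hs, Function.update_apply, hv, raiseTerm, if_pos (hc.2 h1), if_pos (hc'.2 h2),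
        zero_add]
      split_ifs with hm
      · rw [hm, hv, Finsupp.single_eq_same]; ring
      · rw [Finsupp.single_eq_of_ne hm]; ring
    · simp [raiseStep, block, Prog.wp, Instr.Fits, Instr.run, WOp.eval, QOp.eval, Test.Holds, w3,
        w4, q0, i20, i24, i28, i31, hwl, h1, h2, b1, b2, b3, b5, b6, b7, b8, b9, b10, b11, b12]
      simp only [RaiseInv]
      simp [iM', i27, i28, i31, hjd, add_assoc]
      funext m
      rw [iq2, hs, Function.update_apply, Function.update_apply, hv, raiseTerm, if_pos (hc.2 h1),
        if_neg (mt hc'.1 h2), Finsupp.add_apply]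
      by_cases hm : m = J
      · rw [if_neg (show ¬ m = J + 2 ^ j by omega), if_pos hm, hm, hv, Finsupp.single_eq_same,
          Finsupp.single_eq_of_ne (by omega)]
        ring
      · rw [if_neg hm, Finsupp.single_eq_of_ne (a := J) hm]
        split_ifs with hm'
        · rw [hm', Finsupp.single_eq_same]; ring
        · rw [Finsupp.single_eq_of_ne hm']; ring
  · simp [raiseStep, block, Prog.wp, Instr.Fits, Instr.run, WOp.eval, Test.Holds, w3,
      w4, i24, i28, hwl, h1, b1, b2, b3, b4, b5, b10, b11, b12]
    simp only [RaiseInv]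
    simp [iM', i27, i28, i31, hjd, add_assoc]
    funext m
    rw [iq2, hs, raiseTerm, if_neg (mt hc.1 h1), Finsupp.zero_apply, mul_zero, add_zero]

/-- The replacement has been made at the `t` highest positions. -/
def RaiseIterInv (C : ArithCircuit n) (d a k : ℕ) (α : ℚ) (s : State) (c : ℕ →₀ ℚ) (t : ℕ)
    (s' : State) : Prop :=
  (ApolarMem C d a k α s s' ∧ s'.qarr 2 = raiseIter (2 * d) α c t) ∧ s'.wreg 27 = t ∧
  s'.wreg 28 = 2 ^ (2 * d - t)

/-- Register `w₂₈` starts at `2 ^ (2 * d)`, one place above the highest position, and is halved at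
the beginning of each pass. -/
theorem raisePass_spec (hW : WordBound C d W) {a k t : ℕ} {α : ℚ} {c : ℕ →₀ ℚ}
    (ht : t < 2 * d) {s' : State} (h : RaiseIterInv C d a k α s c t s') :
    Triple W raisePass s' (17 * Nat.fib (2 * d + 1) + 5) (RaiseIterInv C d a k α s c (t + 1)) := by
  obtain ⟨⟨iM, iq2⟩, i27, i28⟩ := h
  have iM' := iM
  obtain ⟨⟨⟨⟨-, -, -, w3, w4, w5⟩, -, -, -⟩, w7, w10, w10', w11, wl⟩, -⟩ := iM
  have hsm := hW.small
  have hp0 : 0 < 2 ^ (2 * d) := by positivity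
  have b10 : 1 ≤ W := by omega
  have b11 : 2 ≤ W := by omega
  refine Triple.of_wp_seq (T₁ := 17 * Nat.fib (2 * d + 1) + 1 + 1) ?_
    (by simp only [block, Prog.cost]; omega)
  have hpow : 2 ^ (2 * d - t) = 2 ^ (2 * d - 1 - t) * 2 := by
    rw [← pow_succ]; congr 1; omega
  have hp : 2 ^ (2 * d - t) ≤ 2 ^ (2 * d) := Nat.pow_le_pow_right two_pos (by omega)
  have b1 : 2 ^ (2 * d - 1 - t) * 2 ≤ W := by
    rw [← hpow]; exact hp.trans (by omega)
  have b2 : 2 ^ (2 * d - 1 - t) ≤ W := (Nat.le_mul_of_pos_right _ two_pos).trans b1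
  have b3 : s'.wreg 9 ≤ W := by omega
  simp [block, Prog.wp, Instr.Fits, Instr.run, WOp.eval, w4, w5, i28, hpow, b1, b2, b3, b11]
  refine Triple.seq (T₂ := 1) (Triple.loop (Nat.fib (2 * d + 1)) 16 (RaiseInv C d a k α s
    (raiseIter (2 * d) α c t) t) ?_ (fun r hr s'' h => raiseStep_spec hW hr ht h) ?_ le_rfl) ?_
    (by omega)
  · simp [RaiseInv, iM', i27, pow_succ, iq2, raiseSum]
  · rintro s'' ⟨⟨⟨-, -, w10, -⟩, -⟩, i24, -⟩
    simp only [Test.Holds, i24]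
    omega
  · rintro s'' ⟨iM, -, i27, i28, -, iq2⟩
    have iM' := iM
    obtain ⟨⟨⟨⟨-, -, -, w3, w4, w5⟩, -, -, -⟩, -⟩, -⟩ := iM
    have : 2 * d < 2 ^ (2 * d) := Nat.lt_two_pow_self
    have b12 : t + 1 ≤ W := by omega
    have b13 : t ≤ W := by omega
    refine Triple.of_wp ?_ (by decide)
    simp [Prog.wp, Instr.Fits, Instr.run, WOp.eval, w3, i27, b10, b12, b13]
    simp only [RaiseIterInv]
    simp [iM', iq2, i28, raiseIter]
    omega

theorem raiseProg_spec (hW : WordBound C d W) {a k : ℕ} {α : ℚ} {c : ℕ →₀ ℚ} {s' : State}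
    (hM : ApolarMem C d a k α s s') (hq2 : s'.qarr 2 = c) :
    Triple W raiseProg s' (2 * d * (17 * Nat.fib (2 * d + 1) + 6) + 3) fun s'' =>
      ApolarMem C d a k α s s'' ∧ s''.qarr 2 = raiseIter (2 * d) α c (2 * d) := by
  have hM' := hM
  obtain ⟨⟨⟨⟨-, -, -, w3, w4, w5⟩, -, -, -⟩, -, -, -, w11, -⟩, -⟩ := hM
  have hsm := hW.small
  have b1 : 2 ^ (2 * d) ≤ W := by omega
  refine Triple.of_wp_seq (T₁ := 2 * d * (17 * Nat.fib (2 * d + 1) + 6) + 1) ?_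
    (by simp only [block, Prog.cost]; omega)
  simp [block, Prog.wp, Instr.Fits, Instr.run, WOp.eval, w5, w11, b1]
  refine (Triple.loop (2 * d) (17 * Nat.fib (2 * d + 1) + 5) (RaiseIterInv C d a k α s c) ?_
    (fun t ht s' h => ⟨?_, raisePass_spec hW ht h⟩) ?_ le_rfl).mono le_rfl fun s' h => h.1
  · simp [RaiseIterInv, hM', hq2, raiseIter]
  · obtain ⟨⟨⟨⟨-, w7, -⟩, -⟩, -⟩, i27, -⟩ := h
    simp only [Test.Holds, i27, w7, ht]
  · rintro s' ⟨⟨⟨⟨-, w7, -⟩, -⟩, -⟩, i27, -⟩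
    simp only [Test.Holds, i27, w7, lt_irrefl, not_false_iff]

/-- The workspace is cleared while it is copied, so that the next contraction starts from zero. Only
listed masks are visited, at a cost proportional to F(2d+1) and not to 2^(2d). -/
theorem copyProg_spec (hW : WordBound C d W) {a k : ℕ} (hk : k ≤ C.size) {α : ℚ} {c : ℕ →₀ ℚ}
    (hc : ∀ J, c J ≠ 0 → maskSize J ≤ 2 * d) {s' : State} (hM : ApolarMem C d a k α s s')
    (hq2 : s'.qarr 2 = c) :
    Triple W copyProg s' (7 * Nat.fib (2 * d + 1) + 2) (VecComputed C d k s c) := by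
  have hM' := hM
  obtain ⟨⟨⟨⟨-, -, -, -, -, w5⟩, -, -, -⟩, -, w10, w10', w11, -⟩, h12, -, h14, -, hq1⟩ := hM
  have hsm := hW.small
  have b9 : s'.wreg 9 ≤ W := by omega
  refine Triple.of_wp_seq (T₁ := 7 * Nat.fib (2 * d + 1) + 1) ?_
    (by simp only [block, Prog.cost]; omega)
  simp [block, Prog.wp, Instr.Fits, Instr.run, WOp.eval, w5, b9]
  let I : ℕ → State → Prop := fun t s'' => MainMem C d s'' ∧ s''.wreg 12 = s.wreg 12 ∧
    s''.wreg 14 = k * 2 ^ (2 * d) ∧ s''.wreg 24 = s''.wreg 9 + t ∧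
    Stored d k (s.qarr 1) c t (s''.qarr 1) ∧
    s''.qarr 2 = fun m => if ∃ i < t, maskAt (2 * d + 1) i = m then 0 else c m
  refine (Triple.loop (Nat.fib (2 * d + 1)) 6 I ?_ ?_ ?_ (by omega)).mono le_rfl ?_
  · simp [I, hM'.1, hq2, h12, h14, hq1, Stored.zero]
  · rintro t ht s'' ⟨iM, i12, i14, i24, iS, iq2⟩
    have iM' := iM
    obtain ⟨⟨⟨-, -, -, w3, -, w5⟩, ⟨q0, -, -⟩, -, -⟩, -, w10, w10', w11, wl⟩ := iM
    have hJ := maskAt_lt_two_pow ht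
    have b2 := hW.addr hk (hJ.trans_le (by omega))
    have b4 := hW.base hk
    have b5 : maskAt (2 * d + 1) t ≤ W := by omega
    have b6 : s''.wreg 9 + t ≤ W := by omega
    have b7 : s''.wreg 9 + t + 1 ≤ W := by omega
    have b8 : 1 ≤ W := by omega
    have hv : s''.qarr 2 (maskAt (2 * d + 1) t) = c (maskAt (2 * d + 1) t) := by
      rw [iq2]
      refine if_neg ?_
      rintro ⟨i, hi, he⟩
      exact hi.ne (maskAt_injOn (hi.trans ht) ht he)
    refine ⟨by simp only [Test.Holds, i24]; omega, Triple.of_wp ?_ (by decide)⟩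
    simp [copyStep, block, Prog.wp, Instr.Fits, Instr.run, WOp.eval, w3, i14, i24,
      wl t ht, b2, b4, b5, b6, b7, b8, hv, q0]
    simp only [I]
    simp [iM', i12, i14, add_assoc, iS.update ht]
    funext m
    rw [Function.update_apply, iq2]
    beta_reduce
    by_cases h1 : ∃ i < t, maskAt (2 * d + 1) i = m
    · obtain ⟨i, hi, hm⟩ := h1
      rw [if_pos (⟨i, hi, hm⟩ : ∃ i < t, maskAt (2 * d + 1) i = m),
        if_pos (⟨i, hi.le, hm⟩ : ∃ i ≤ t, maskAt (2 * d + 1) i = m), ite_self]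
    · by_cases h2 : m = maskAt (2 * d + 1) t
      · rw [if_pos h2, if_pos ⟨t, le_rfl, h2.symm⟩]
      · rw [if_neg h2, if_neg h1, if_neg]
        rintro ⟨i, hi, hm⟩
        rcases Nat.lt_or_eq_of_le hi with hi | rfl
        · exact h1 ⟨i, hi, hm⟩
        · exact h2 hm.symm
  · rintro s'' ⟨⟨-, -, w10, -⟩, -, -, i24, -⟩
    simp only [Test.Holds, i24]
    omega
  · rintro s'' ⟨iM, i12, -, -, iS, iq2⟩
    refine ⟨iM, i12, ?_, iS⟩
    rw [iq2]
    funext m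
    -- Every nonzero coordinate belongs to a mask of the list and was cleared; the others were zero
    -- already.
    by_cases h : c m = 0
    · rw [h, ite_self]
    · exact if_pos (exists_maskAt (Nat.lt_succ_of_le (hc m h)))

/-- Store in block `w₁₄` the effect of `apolarOp α` on block `w₁₃`, where `α` is the index of the
variable at gate `w₁₅`. -/
def apolarProg : Prog := .seq alphaProg (.seq contractProg (.seq raiseProg copyProg))

/-- A word cannot be converted into a rational, so α is counted up from zero; this is the origin of
the term 3n. -/
theorem alphaProg_spec (hW : WordBound C d W) {a k i : ℕ} (hi : i < n) (hM : MainMem C d s)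
    (h13 : s.wreg 13 = a * 2 ^ (2 * d)) (h14 : s.wreg 14 = k * 2 ^ (2 * d))
    (h15 : s.wreg 15 < C.size) (hg : s.warr 1 (s.wreg 15) = i) (hq2 : s.qarr 2 = fun _ => 0) :
    Triple W alphaProg s (3 * n + 4) fun s' => ApolarMem C d a k i s s' ∧
      s'.qarr 2 = fun _ => 0 := by
  have hM' := hM
  obtain ⟨⟨⟨-, -, -, w3, -, w5⟩, ⟨q0, q1, -⟩, -, -⟩, -⟩ := hM
  obtain ⟨hW1, hW2, -⟩ := hW
  have b1 : s.wreg 15 ≤ W := by omega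
  have b2 : i ≤ W := by omega
  have b3 : 1 ≤ W := by omega
  refine Triple.of_wp_seq (T₁ := 3 * i + 1) ?_ (by simp only [block, Prog.cost]; omega)
  simp [block, Prog.wp, Instr.Fits, Instr.run, WOp.eval, QOp.eval, w5, hg, b1, b2, q0]
  let I : ℕ → State → Prop := fun t s' => (ApolarMem C d a k t s s' ∧
    s'.qarr 2 = fun _ => 0) ∧ s'.wreg 16 = i ∧ s'.wreg 17 = t
  refine (Triple.loop i 2 I ?_ ?_ ?_ (by omega)).mono le_rfl fun s' h => h.1
  · simp only [I]
    simp [ApolarMem, hM', h13, h14, hq2]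
  · rintro t ht s' ⟨⟨⟨iM, i12, i13, i14, i20, iq1⟩, iq2⟩, i16, i17⟩
    have iM' := iM
    obtain ⟨⟨⟨-, -, -, w3, -, w5⟩, ⟨q0, q1, -⟩, -, -⟩, -⟩ := iM
    have b4 : t ≤ W := by omega
    have b5 : t + 1 ≤ W := by omega
    refine ⟨by simp only [Test.Holds, i16, i17, ht], Triple.of_wp ?_ (by decide)⟩
    simp [Prog.wp, Instr.Fits, Instr.run, WOp.eval, QOp.eval, w3, i17, b3, b4, b5, q1]
    simp only [I]
    simp [ApolarMem, iM', i12, i13, i14, i16, i20, iq1, iq2]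
  · rintro s' ⟨-, i16, i17⟩
    simp only [Test.Holds, i16, i17, lt_irrefl, not_false_iff]

theorem apolarProg_spec (hW : WordBound C d W) (hM : MainMem C d s) {a k i : ℕ} (ha : a ≤ C.size)
    (hk : k ≤ C.size) (hi : i < n)
    (h13 : s.wreg 13 = a * 2 ^ (2 * d)) (h14 : s.wreg 14 = k * 2 ^ (2 * d))
    (h15 : s.wreg 15 < C.size) (hg : s.warr 1 (s.wreg 15) = i) (hq2 : s.qarr 2 = fun _ => 0) :
    Triple W apolarProg s (58 * d * Nat.fib (2 * d + 1) + 15 * Nat.fib (2 * d + 1) + 12 * d +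
      3 * n + 11) (VecComputed C d k s (apolarCoord (2 * d) i (vecAt d s a))) := by
  -- Here 58 = 24 + 34 collects the 2d · 12 steps per mask of the contraction and the 2d · 17 of the
  -- replacements; 15 = 8 + 7 collects the other costs per mask of the contraction and the copy.
  refine Triple.seq (alphaProg_spec hW hi hM h13 h14 h15 hg hq2) (fun s₁ h₁ => ?_)
    (T₂ := 58 * d * Nat.fib (2 * d + 1) + 15 * Nat.fib (2 * d + 1) + 12 * d + 7) (by omega)
  have hv : vecAt d s₁ a = vecAt d s a := by
    funext J
    rw [vecAt, vecAt, h₁.1.2.2.2.2.2]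
  -- The reference state is moved past `alphaProg`, which changes neither the counter nor the stored
  -- vectors.
  have hM₁ : ApolarMem C d a k i s₁ s₁ := ⟨h₁.1.1, rfl, h₁.1.2.2.1, h₁.1.2.2.2.1,
    h₁.1.2.2.2.2.1, rfl⟩
  refine Triple.seq (contractProg_spec hW ha hM₁ h₁.2) (fun s₂ h₂ => ?_)
    (T₂ := 34 * d * Nat.fib (2 * d + 1) + 7 * Nat.fib (2 * d + 1) + 12 * d + 5) (by
      ring_nf; omega)
  refine Triple.seq (raiseProg_spec hW h₂.1 h₂.2) (fun s₃ h₃ => ?_)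
    (T₂ := 7 * Nat.fib (2 * d + 1) + 2) (by ring_nf; omega)
  refine (copyProg_spec hW hk (fun J hJ => ?_) h₃.1 h₃.2).mono le_rfl fun s₄ h₄ => ?_
  · exact apolarCoord_ne_zero (α := i) (c := vecAt d s₁ a) hJ
  · obtain ⟨h5, h6, h7, h8⟩ := h₄
    rw [h₁.1.2.2.2.2.2, hv] at h8
    exact ⟨h5, h6.trans h₁.1.2.1, h7, h8⟩

end Specs

end RAM

/-! ### The algorithm -/

theorem Gate.code_fst_lt_two_iff {n k : ℕ} (g : Gate n k) : g.code.1 < 2 ↔ g.IsInput := by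
  cases g <;> simp [Gate.code, Gate.IsInput]

namespace RAM

/-- Store the coordinates of `1 ∧ X ∧ ⋯ ∧ X ^ (d - 1)` in the block after those of the gates. -/
def startProg : Prog :=
  .seq (block [.wop .add 13 3 5, .wop .add 12 5 5]) <|
  .seq (.loop (.wlt 12 6) (block [.wop .add 13 13 13, .wop .add 12 12 3])) <|
  block [.wop .sub 13 13 3, .wop .mul 14 1 11, .wop .add 14 14 13, .qstore 1 14 1,
    .wop .add 12 5 5]

/-- Store in block `w₁₄` the effect of the input gate `w₁₅` on the vector in block `w₁₃`. -/
def inputProg : Prog :=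
  .seq (block [.wload 23 0 15]) <|
  .ite (.weq 23 3) (.seq (block [.qload 20 0 15]) scaleProg) apolarProg

/-- For the gate `w₁₂`, an input or a product gate, find the input gate `w₁₅` and the block `w₁₃`
on which it has to act. -/
def decodeProg : Prog :=
  .ite (.wlt 4 20) (.seq (block [.wload 21 1 12, .wload 22 2 12, .wload 23 0 21])
      (.ite (.wlt 23 4) (block [.wop .add 15 21 5, .wop .mul 13 22 11])
        (block [.wop .add 15 22 5, .wop .mul 13 21 11])))
    (block [.wop .add 15 12 5, .wop .mul 13 1 11])

/-- Compute the vector of gate `w₁₂`. -/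
def gateStep : Prog :=
  .seq (block [.wload 20 0 12, .wop .mul 14 12 11]) <|
  .seq (.ite (.weq 20 4)
    (.seq (block [.wload 21 1 12, .wload 22 2 12, .wop .mul 21 21 11, .wop .mul 22 22 11]) addProg)
    (.seq decodeProg inputProg)) <|
  block [.wop .add 12 12 3]

def answerProg : Prog :=
  .seq (block [.wop .mul 13 2 11, .qload 10 1 13]) <|
  .ite (.qzero 10) (.instr (.wconst 0 0)) (.instr (.wconst 0 1))

def mainProg : Prog :=
  .seq listPrep <| .seq (.loop (.wlt 12 7) listStep) <| .seq startProg <|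
  .seq (.loop (.wlt 12 1) gateStep) answerProg

/-- The whole algorithm. -/
def fullProg : Prog :=
  .seq initBlock <| .seq (.loop (.wlt 12 1) evalStep) <| .seq degreePrep <|
  .ite (.qzero 20) (.instr (.wconst 0 0)) <|
  .seq (.loop (.wlt 12 13) degreeStep) <| .ite (.wlt 6 13) mainProg (.instr (.wconst 0 0))

section Specs

variable {n d W : ℕ} {C : ArithCircuit n} {s : State}
  {Ψ : MvPolynomial (Fin n) ℚ →ₐ[ℚ] Module.End ℚ PolyWedge}

/-- The vectors of the first `t` gates are computed. -/
def GateInv (C : ArithCircuit n) (d : ℕ)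
    (Ψ : MvPolynomial (Fin n) ℚ →ₐ[ℚ] Module.End ℚ PolyWedge) (t : ℕ) (s : State) : Prop :=
  MainMem C d s ∧ s.wreg 12 = t ∧ s.qarr 2 = (fun _ => 0) ∧
  wedgeOf (2 * d) (vecAt d s C.size) = powerWedge 1 d ∧
  ∀ k (hk : k < C.size), k < t →
    wedgeOf (2 * d) (vecAt d s k) = Ψ (C.gatePoly k hk) (powerWedge 1 d)

/-- The array of vectors is still zero, so storing a 1 at the mask `2 ^ d - 1` of the extra block
`C.size` creates the whole start vector. -/
theorem startProg_spec (hW : WordBound C d W) (h : ListBase C d (2 * d) s) :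
    Triple W startProg s (3 * d + 8) (GateInv C d Ψ 0) := by
  obtain ⟨hI, h6, h7, h8, h9, h10, h11, h12, hq1, hq2, hl, hl'⟩ := h
  have f3 : Nat.fib (2 * d + 3) = Nat.fib (2 * d + 1) + Nat.fib (2 * d + 2) := Nat.fib_add_two
  have hf : Nat.fib (2 * d + 3) ≤ 2 ^ (2 * d + 2) := fib_succ_le_two_pow _
  have hp : 2 ^ (2 * d + 2) = 4 * 2 ^ (2 * d) := by ring
  have hM : MainMem C d s := ⟨hI, h7, by omega, by omega, h11, hl'⟩
  obtain ⟨⟨w0, w1, w2, w3, w4, w5⟩, -, -, -⟩ := hI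
  have hsm := hW.small
  have hp0 : 0 < 2 ^ (2 * d) := by positivity
  have b1 : 1 ≤ W := by omega
  refine Triple.of_wp_seq (T₁ := d * 3 + 1 + 5) ?_ (by simp only [block, Prog.cost]; omega)
  simp [block, Prog.wp, Instr.Fits, Instr.run, WOp.eval, w3, w5, b1]
  let I : ℕ → State → Prop := fun t s' => MainMem C d s' ∧ s'.wreg 6 = d ∧ s'.wreg 12 = t ∧
    s'.wreg 13 = 2 ^ t ∧ s'.qarr 1 = (fun _ => 0) ∧ s'.qarr 2 = fun _ => 0
  refine Triple.seq (T₂ := 5) (Triple.loop d 2 I ?_ ?_ ?_ le_rfl) ?_ le_rfl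
  · simp [I, hM, h6, hq1, hq2]
  · rintro t ht s' ⟨iM, i6, i12, i13, iq1, iq2⟩
    have iM' := iM
    obtain ⟨⟨⟨-, -, -, w3, -, w5⟩, -, -, -⟩, -⟩ := iM
    have hp1 : 2 ^ (t + 1) = 2 ^ t + 2 ^ t := by ring
    have hp2 : 2 ^ (t + 1) ≤ 2 ^ (2 * d) := Nat.pow_le_pow_right two_pos (by omega)
    have ht' : t < 2 ^ t := Nat.lt_two_pow_self
    have b2 : 2 ^ t ≤ W := by omega
    have b3 : 2 ^ t + 2 ^ t ≤ W := by omega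
    have b4 : t ≤ W := by omega
    have b5 : t + 1 ≤ W := by omega
    refine ⟨by simp only [Test.Holds, i12, i6, ht], Triple.of_wp ?_ (by decide)⟩
    simp [Prog.wp, Instr.Fits, Instr.run, WOp.eval, w3, i12, i13, b1, b2, b3, b4, b5]
    simp only [I]
    simp [iM', i6, iq1, iq2, hp1]
  · rintro s' ⟨-, i6, i12, -⟩
    simp only [Test.Holds, i12, i6, lt_irrefl, not_false_iff]
  · rintro s' ⟨iM, i6, i12, i13, iq1, iq2⟩
    have iM' := iM
    obtain ⟨⟨⟨-, w1, -, w3, -, w5⟩, ⟨-, q1, -⟩, -, -⟩, -, -, -, w11, -⟩ := iM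
    have hp2 : 2 ^ d ≤ 2 ^ (2 * d) := Nat.pow_le_pow_right two_pos (by omega)
    have b2 : 2 ^ d ≤ W := by omega
    have b3 : 2 ^ d - 1 ≤ W := by omega
    have b4 := hW.2.1
    have b5 : C.size ≤ W := by omega
    have b6 : 2 ^ (2 * d) ≤ W := by omega
    have b7 := hW.base (k := C.size) le_rfl
    have b8 := hW.addr (k := C.size) (J := 2 ^ d - 1) le_rfl (by omega)
    refine Triple.of_wp ?_ (by decide)
    simp [Prog.wp, Instr.Fits, Instr.run, WOp.eval, w1, w3, w5, w11, i13, b1, b3, b5, b6, b7,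
      b8, q1]
    refine ⟨by omega, ?_⟩
    simp only [GateInv]
    simp [iM', iq2]
    rw [← wedgeOf_single]
    congr 1
    funext J
    simp [vecAt, iq1, Function.update_apply, Finsupp.single_apply, eq_comm]

theorem vecComputed_wedgeOf {k : ℕ} {f : ℕ → ℚ} {s' : State} (h : VecComputed C d k s f s') :
    wedgeOf (2 * d) (vecAt d s' k) = wedgeOf (2 * d) f :=
  wedgeOf_congr fun i hi => h.2.2.2.1 i hi

theorem vecComputed_wedgeOf_of_ne {k k' : ℕ} {f : ℕ → ℚ} {s' : State}
    (h : VecComputed C d k s f s') (hk : k' ≠ k) :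
    wedgeOf (2 * d) (vecAt d s' k') = wedgeOf (2 * d) (vecAt d s k') :=
  wedgeOf_congr fun _ hi => h.2.2.2.2 k' hk _ (maskAt_lt_two_pow hi)

theorem inputProg_spec (hΨ : ∀ i, Ψ (MvPolynomial.X i) = apolarOp ((i : ℕ) : ℚ))
    (hW : WordBound C d W) (hM : MainMem C d s) {a k g : ℕ} (ha : a ≤ C.size)
    (hk : k ≤ C.size) (hak : a ≠ k) (hg : g < C.size) (hin : (C.gate ⟨g, hg⟩).IsInput)
    (h13 : s.wreg 13 = a * 2 ^ (2 * d)) (h14 : s.wreg 14 = k * 2 ^ (2 * d))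
    (h15 : s.wreg 15 = g) (hq2 : s.qarr 2 = fun _ => 0) :
    Triple W inputProg s (58 * d * Nat.fib (2 * d + 1) + 15 * Nat.fib (2 * d + 1) + 12 * d +
      3 * n + 14) fun s' => ∃ f, VecComputed C d k s f s' ∧
        wedgeOf (2 * d) f = Ψ (C.gatePoly g hg) (wedgeOf (2 * d) (vecAt d s a)) := by
  have hM' := hM
  obtain ⟨⟨⟨-, -, -, w3, -, w5⟩, -, ⟨a0, a1, a2⟩, b0⟩, -⟩ := hM
  have e0 := C.input_warr_zero hg
  have e1 := C.input_warr_one hg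
  have e3 := C.input_qarr_zero hg
  have hW1 := hW.2.1
  have b1 : g ≤ W := by omega
  have b2 : 1 ≤ W := by omega
  refine Triple.of_wp_seq (T₁ := 58 * d * Nat.fib (2 * d + 1) + 15 * Nat.fib (2 * d + 1) +
    12 * d + 3 * n + 13) ?_ (by simp only [block, Prog.cost]; omega)
  cases hgate : C.gate ⟨g, hg⟩ with
  | var i =>
    simp only [hgate, Gate.code] at e0 e1
    simp [block, Prog.wp, Instr.Fits, Instr.run, h15, a0, e0, b1]
    refine Triple.ite (T₁ := 58 * d * Nat.fib (2 * d + 1) + 15 * Nat.fib (2 * d + 1) +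
      12 * d + 3 * n + 12) (fun h => ?_) (fun _ => ?_) le_rfl
    · simp [Test.Holds, w3] at h
    · refine (apolarProg_spec (s := s.setW 23 0) hW (by simpa using hM') ha hk i.isLt
        (by simpa using h13) (by simpa using h14) (by simpa [h15] using hg)
        (by simp [h15, a1, e1]) hq2).mono (by omega) fun s' h =>
          ⟨apolarCoord (2 * d) (i : ℕ) (vecAt d s a), ?_, ?_⟩
      · exact h
      · rw [wedgeOf_apolarCoord, C.gatePoly_var hg hgate, hΨ]
  | scalar c =>
    simp only [hgate, Gate.code, Gate.scalarPart] at e0 e1 e3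
    simp [block, Prog.wp, Instr.Fits, Instr.run, h15, a0, e0, b1, b2]
    refine Triple.ite (T₁ := 58 * d * Nat.fib (2 * d + 1) + 15 * Nat.fib (2 * d + 1) +
      12 * d + 3 * n + 12) (fun _ => ?_) (fun h => ?_) le_rfl
    · refine Triple.of_wp_seq (T₁ := 58 * d * Nat.fib (2 * d + 1) + 15 * Nat.fib (2 * d + 1) +
        12 * d + 3 * n + 11) ?_ (by simp only [Prog.cost]; omega)
      simp [Prog.wp, Instr.Fits, Instr.run, h15, b1, b0, e3]
      refine (scaleProg_spec (s := (s.setW 23 1).setQ 20 c) hW (by simpa using hM') ha hk hak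
        (by simpa using h13) (by simpa using h14) hq2).mono (by omega) fun s' h =>
          ⟨fun J => c * vecAt d s a J, ?_, ?_⟩
      · simp at h
        exact h
      · rw [wedgeOf_const_mul, C.gatePoly_scalar hg hgate, ← MvPolynomial.algebraMap_eq,
          AlgHom.commutes, Module.algebraMap_end_apply]
    · simp [Test.Holds, w3] at h
  | add a b => simp [hgate, Gate.IsInput] at hin
  | mul a b => simp [hgate, Gate.IsInput] at hin

/-- The polynomial of gate `k` is the one of the input gate `w₁₅`, times the polynomial whose vector
is in block `w₁₃`. -/
def Decoded (C : ArithCircuit n) (d k : ℕ) (hk : k < C.size) (s s' : State) : Prop :=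
  (MainMem C d s' ∧ s'.wreg 12 = k ∧ s'.wreg 14 = s.wreg 14 ∧ s'.qarr = s.qarr) ∧
  ∃ (a g : ℕ) (hg : g < C.size), (C.gate ⟨g, hg⟩).IsInput ∧ s'.wreg 15 = g ∧
    s'.wreg 13 = a * 2 ^ (2 * d) ∧
    ((a = C.size ∧ C.gatePoly k hk = C.gatePoly g hg) ∨
      ∃ ha : a < C.size, a < k ∧ C.gatePoly k hk = C.gatePoly g hg * C.gatePoly a ha)

/-- An input gate is treated as a product with 1, whose vector is the start vector in block
`C.size`. For a product gate, skewness makes the second operand an input whenever the first is not.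
-/
theorem decodeProg_spec (hW : WordBound C d W) (hM : MainMem C d s) {k : ℕ} (hk : k < C.size)
    (hadd : (C.gate ⟨k, hk⟩).code.1 ≠ 2) (hskew : C.IsSkew) (h12 : s.wreg 12 = k)
    (h20 : s.wreg 20 = (C.gate ⟨k, hk⟩).code.1) :
    Triple W decodeProg s 10 (Decoded C d k hk s) := by
  have hM' := hM
  obtain ⟨⟨⟨-, w1, -, w3, w4, w5⟩, -, ⟨a0, a1, a2⟩, -⟩, -, -, -, w11, -⟩ := hM
  have e0 := C.input_warr_zero hk
  have e1 := C.input_warr_one hk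
  have e2 := C.input_warr_two hk
  have hW1 := hW.2.1
  have hsm := hW.small
  have b1 : k ≤ W := by omega
  have b2 : 2 ^ (2 * d) ≤ W := by omega
  have b4 : C.size ≤ W := by omega
  have b5 := hW.base (k := C.size) le_rfl
  refine Triple.of_wp ?_ (by decide)
  cases hgate : C.gate ⟨k, hk⟩ with
  | var i =>
    simp only [hgate, Gate.code] at h20
    simp [decodeProg, block, Prog.wp, Instr.Fits, Instr.run, WOp.eval, Test.Holds, w1, w4, w5, w11,
      h12, h20, b1, b2, b4, b5]
    exact ⟨by simp [hM', h12], C.size, k, hk, by simp [hgate, Gate.IsInput], by simp, by simp,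
      .inl ⟨rfl, rfl⟩⟩
  | scalar c =>
    simp only [hgate, Gate.code] at h20
    simp [decodeProg, block, Prog.wp, Instr.Fits, Instr.run, WOp.eval, Test.Holds, w1, w4, w5, w11,
      h12, h20, b1, b2, b4, b5]
    exact ⟨by simp [hM', h12], C.size, k, hk, by simp [hgate, Gate.IsInput], by simp, by simp,
      .inl ⟨rfl, rfl⟩⟩
  | add a b => simp [hgate, Gate.code] at hadd
  | mul a b =>
    simp only [hgate, Gate.code] at h20 e1 e2
    have ha := a.isLt.trans hk
    have hb := b.isLt.trans hk
    have ea := C.input_warr_zero ha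
    have hcode : ∀ {k : ℕ} (g : Gate n k), g.code.1 ≤ 3 := fun g => by cases g <;> simp [Gate.code]
    have b6 : (C.gate ⟨a, ha⟩).code.1 ≤ W := (hcode _).trans (by omega)
    have b7 : (a : ℕ) ≤ W := by omega
    have b8 : (b : ℕ) ≤ W := by omega
    have b9 := hW.base ha.le
    have b10 := hW.base hb.le
    by_cases hc : (C.gate ⟨a, ha⟩).code.1 < 2
    · simp [decodeProg, block, Prog.wp, Instr.Fits, Instr.run, WOp.eval, Test.Holds, w4, w5, w11,
        h12, h20, b1, b2, a0, a1, a2, e1, e2, ea, b6, b7, b8, b10, hc]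
      exact ⟨by simp [hM', h12], b, a, ha, (Gate.code_fst_lt_two_iff _).1 hc, by simp, by simp,
        .inr ⟨hb, b.isLt, C.gatePoly_mul hk hgate⟩⟩
    · have hin := (hskew ⟨k, hk⟩ a b hgate).resolve_left
        (mt (Gate.code_fst_lt_two_iff _).2 hc)
      simp [decodeProg, block, Prog.wp, Instr.Fits, Instr.run, WOp.eval, Test.Holds, w4, w5, w11,
        h12, h20, b1, b2, a0, a1, a2, e1, e2, ea, b6, b7, b8, b9, hc]
      exact ⟨by simp [hM', h12], a, b, hb, hin, by simp, by simp,
        .inr ⟨ha, a.isLt, (C.gatePoly_mul hk hgate).trans (mul_comm _ _)⟩⟩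

theorem gateStep_spec (hΨ : ∀ i, Ψ (MvPolynomial.X i) = apolarOp ((i : ℕ) : ℚ))
    (hW : WordBound C d W) (hskew : C.IsSkew) {k : ℕ} (hk : k < C.size)
    (h : GateInv C d Ψ k s) :
    Triple W gateStep s (58 * d * Nat.fib (2 * d + 1) + 15 * Nat.fib (2 * d + 1) + 12 * d +
      3 * n + 28) (GateInv C d Ψ (k + 1)) := by
  obtain ⟨hM, h12, hq2, hv, hvk⟩ := h
  have hM' := hM
  obtain ⟨⟨⟨-, -, -, w3, w4, w5⟩, -, ⟨a0, a1, a2⟩, -⟩, -, -, -, w11, -⟩ := hM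
  have e0 := C.input_warr_zero hk
  have e1 := C.input_warr_one hk
  have e2 := C.input_warr_two hk
  have hcode : (C.gate ⟨k, hk⟩).code.1 ≤ 3 := by
    cases C.gate ⟨k, hk⟩ <;> simp [Gate.code]
  have hW1 := hW.2.1
  have hsm := hW.small
  have b1 : k ≤ W := by omega
  have b2 : 2 ^ (2 * d) ≤ W := by omega
  have b3 : (C.gate ⟨k, hk⟩).code.1 ≤ W := by omega
  have b5 := hW.base hk.le
  refine Triple.of_wp_seq (T₁ := 58 * d * Nat.fib (2 * d + 1) + 15 * Nat.fib (2 * d + 1) +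
    12 * d + 3 * n + 26) ?_ (by simp only [block, Prog.cost]; omega)
  simp [block, Prog.wp, Instr.Fits, Instr.run, WOp.eval, h12, a0, e0, w11, b1, b2, b3, b5]
  refine Triple.seq (T₁ := 58 * d * Nat.fib (2 * d + 1) + 15 * Nat.fib (2 * d + 1) +
    12 * d + 3 * n + 25) (T₂ := 1) (R := fun s' => ∃ f, VecComputed C d k s f s' ∧
      wedgeOf (2 * d) f = Ψ (C.gatePoly k hk) (powerWedge 1 d)) ?_ ?_ le_rfl
  · refine Triple.ite (T₁ := 58 * d * Nat.fib (2 * d + 1) + 15 * Nat.fib (2 * d + 1) +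
      12 * d + 3 * n + 24) (fun hc => ?_) (fun hc => ?_) le_rfl
    · simp [Test.Holds, w4] at hc
      cases hgate : C.gate ⟨k, hk⟩ with
      | var i => simp [hgate, Gate.code] at hc
      | scalar c => simp [hgate, Gate.code] at hc
      | mul a b => simp [hgate, Gate.code] at hc
      | add a b =>
        simp only [hgate, Gate.code] at e1 e2
        have ha := a.isLt.trans hk
        have hb := b.isLt.trans hk
        have b6 : (a : ℕ) ≤ W := by omega
        have b7 : (b : ℕ) ≤ W := by omega
        have b8 := hW.base ha.le
        have b9 := hW.base hb.le
        refine Triple.of_wp_seq (T₁ := 10 * Nat.fib (2 * d + 1) + 2) ?_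
          (by simp only [Prog.cost]; omega)
        simp [Prog.wp, Instr.Fits, Instr.run, WOp.eval, h12, a1, a2, e1, e2, w11, b1, b2, b6, b7,
          b8, b9]
        refine (addProg_spec (a := a) (b := b) (k := k) hW (by simpa using hM') ha.le hb.le hk.le
          a.isLt.ne b.isLt.ne (by simp) (by simp) (by simp) (by simpa using hq2)).mono le_rfl
          fun s' h => ⟨fun J => vecAt d s a J + vecAt d s b J, ?_, ?_⟩
        · exact h
        · rw [wedgeOf_add, hvk a ha a.isLt, hvk b hb b.isLt, C.gatePoly_add hk hgate, map_add,
            LinearMap.add_apply]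
    · simp [Test.Holds, w4] at hc
      refine Triple.seq (T₂ := 58 * d * Nat.fib (2 * d + 1) + 15 * Nat.fib (2 * d + 1) +
        12 * d + 3 * n + 14) (decodeProg_spec hW (by simpa using hM') hk hc hskew (by simpa using h12)
          (by simp)) ?_ (by omega)
      rintro s₁ ⟨⟨i1, i2, i3, i4⟩, a, g, hg, hin, i15, i13, hor⟩
      have hvec : ∀ j, vecAt d s₁ j = vecAt d s j := fun j => by
        funext J; rw [vecAt, vecAt, i4]; rfl
      -- The source is the start block or the block of an earlier gate, so it is not overwritten.
      have hak : a ≠ k := by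
        rcases hor with ⟨h, -⟩ | ⟨-, h, -⟩ <;> omega
      have ha : a ≤ C.size := by
        rcases hor with ⟨h, -⟩ | ⟨-, h, -⟩ <;> omega
      refine (inputProg_spec hΨ hW i1 ha hk.le hak hg hin i13 (by simpa using i3) i15
        (by simpa [hq2] using congrFun i4 2)).mono le_rfl ?_
      rintro s' ⟨f, ⟨j1, j2, j3, j4⟩, hf⟩
      refine ⟨f, ⟨j1, by rw [j2, i2, h12], j3, ?_⟩, ?_⟩
      · rw [i4] at j4; exact j4
      · rw [hf, hvec]
        rcases hor with ⟨rfl, hp⟩ | ⟨ha', hlt, hp⟩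
        · rw [hv, hp]
        · rw [hvk a ha' hlt, hp, map_mul, Module.End.mul_apply]
  · rintro s' ⟨f, hf, hfv⟩
    have hfM := hf.1
    obtain ⟨⟨⟨-, -, -, w3', -, -⟩, -, -, -⟩, -⟩ := hfM
    have hf12 := hf.2.1
    have b10 : 1 ≤ W := by omega
    have b11 : k + 1 ≤ W := by omega
    refine Triple.of_wp ?_ (by decide)
    simp [Prog.wp, Instr.Fits, Instr.run, WOp.eval, w3', hf12, h12, b1, b10, b11]
    refine ⟨by simpa using hf.1, by simp, hf.2.2.1, ?_, ?_⟩
    · exact (vecComputed_wedgeOf_of_ne hf hk.ne').trans hv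
    · intro j hj hjk
      by_cases hjk' : j = k
      · subst hjk'
        exact (vecComputed_wedgeOf hf).trans hfv
      · exact (vecComputed_wedgeOf_of_ne hf hjk').trans (hvk j hj (by omega))

end Specs

end RAM

/-! ### Correctness of the answer and the total running time -/

namespace RAM

variable {n d W : ℕ} {C : ArithCircuit n} {s : State}
  {Ψ : MvPolynomial (Fin n) ℚ →ₐ[ℚ] Module.End ℚ PolyWedge}

/-- The register `w₀` holds the right answer. -/
def Answered (C : ArithCircuit n) (d : ℕ) (s : State) : Prop :=
  (HasSquareFreeMonomial d C.poly → s.wreg 0 = 1) ∧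
    (¬ HasSquareFreeMonomial d C.poly → s.wreg 0 = 0)

theorem answerProg_spec (hΨ : ∀ i, Ψ (MvPolynomial.X i) = apolarOp ((i : ℕ) : ℚ))
    (hW : WordBound C d W) (hd : C.poly.IsHomogeneous d) (h0 : ∀ m, 0 ≤ C.poly.coeff m)
    (h : GateInv C d Ψ C.size s) : Triple W answerProg s 4 (Answered C d) := by
  obtain ⟨hM, -, -, -, hv⟩ := h
  obtain ⟨r, hr, hiff⟩ := apolarEval_apply_powerWedge hΨ hd h0
  -- The final vector is a scalar, and its coordinate at the empty mask is the first cell of the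
  -- output block.
  have hr0 : s.qarr 1 (C.out * 2 ^ (2 * d)) = r := by
    have := algebraMapInv_wedgeOf (2 * d) (vecAt d s C.out)
    rw [hv _ C.out.isLt C.out.isLt] at this
    change ExteriorAlgebra.algebraMapInv (Ψ C.poly _) = _ at this
    rw [hr, ExteriorAlgebra.algebraMap_leftInverse] at this
    exact this.symm
  obtain ⟨⟨⟨-, -, w2, -, -, -⟩, -, -, -⟩, -, -, -, w11, -⟩ := hM
  have hsm := hW.small
  have hW1 := hW.2.1
  have hout := C.out.isLt
  have b1 : (C.out : ℕ) ≤ W := by omega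
  have b2 : 2 ^ (2 * d) ≤ W := by omega
  have b3 := hW.base hout.le
  have b4 : 1 ≤ W := by omega
  refine Triple.of_wp ?_ (by decide)
  by_cases hz : r = 0
  · simp [answerProg, block, Prog.wp, Instr.Fits, Instr.run, WOp.eval, Test.Holds, w2, w11, b1, b2,
      b3, hr0, hz, Answered, ← hiff]
  · simp [answerProg, block, Prog.wp, Instr.Fits, Instr.run, WOp.eval, Test.Holds, w2, w11, b1, b2,
      b3, b4, hr0, hz, Answered, ← hiff]

theorem mainProg_spec (hW : WordBound C d W) (hskew : C.IsSkew) (hd : C.poly.IsHomogeneous d)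
    (h0 : ∀ m, 0 ≤ C.poly.coeff m) {u : ℚ} (hdn : d < n + 1) (h : DegreeInv C d u (n + 1) s) :
    Triple W mainProg s (2 * d * (8 * Nat.fib (2 * d + 1) + 9) + 3 * d + 20 +
      C.size * (58 * d * Nat.fib (2 * d + 1) + 15 * Nat.fib (2 * d + 1) + 12 * d + 3 * n + 29))
      (Answered C d) := by
  obtain ⟨Ψ, hΨ⟩ := exists_apolarEval n
  generalize hG : 58 * d * Nat.fib (2 * d + 1) + 15 * Nat.fib (2 * d + 1) + 12 * d + 3 * n + 29 = G
  have hGs : C.size * G = C.size * (58 * d * Nat.fib (2 * d + 1) + 15 * Nat.fib (2 * d + 1) +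
    12 * d + 3 * n + 28 + 1) := by rw [← hG]
  refine Triple.seq (listPrep_spec C hW.small hdn h) (fun s₁ h₁ => ?_)
    (T₂ := 2 * d * (8 * Nat.fib (2 * d + 1) + 9) + 3 * d + 14 + C.size * G) (by omega)
  refine Triple.seq (listLoop_spec C hW.small h₁) (fun s₂ h₂ => ?_)
    (T₂ := 3 * d + 13 + C.size * G) (by omega)
  refine Triple.seq (startProg_spec (Ψ := Ψ) hW h₂) (fun s₃ h₃ => ?_) (T₂ := C.size * G + 5) (by omega)
  refine Triple.seq (T₁ := C.size * G + 1) (Triple.loop C.size _ (GateInv C d Ψ) h₃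
    (fun t ht s' h' => ⟨?_, gateStep_spec hΨ hW hskew ht h'⟩) (fun s' h' => ?_) (by rw [hGs]))
    (fun s₄ h₄ => answerProg_spec hΨ hW hd h0 h₄) (by omega)
  · simp only [Test.Holds, h'.2.1, h'.1.1.1.2.1, ht]
  · simp only [Test.Holds, h'.2.1, h'.1.1.1.2.1, lt_irrefl, not_false_iff]

theorem not_hasSquareFreeMonomial_of_lt {n d : ℕ} {g : MvPolynomial (Fin n) ℚ} (h : n < d) :
    ¬ HasSquareFreeMonomial d g := by
  rintro ⟨m, -, hm, h1⟩
  have : m.degree ≤ n := by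
    rw [Finsupp.degree_eq_sum]
    exact (Finset.sum_le_card_nsmul _ _ 1 fun i _ => h1 i).trans (by simp)
  omega

/-- The value at (1,…,1) is the sum of the coefficients, none of which is negative. -/
theorem eq_zero_of_eval_one_eq_zero {n : ℕ} {g : MvPolynomial (Fin n) ℚ}
    (h0 : ∀ m, 0 ≤ g.coeff m) (h : MvPolynomial.eval (fun _ => 1) g = 0) : g = 0 := by
  rw [MvPolynomial.eval_eq] at h
  simp only [one_pow, Finset.prod_const_one, mul_one] at h
  rw [Finset.sum_eq_zero_iff_of_nonneg fun m _ => h0 m] at h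
  ext m
  by_cases hm : m ∈ g.support
  · exact h m hm
  · simpa using hm

theorem answered_zero (h : ¬ HasSquareFreeMonomial d C.poly) (T : ℕ) (hT : 1 ≤ T) :
    Triple W (.instr (.wconst 0 0)) s T (Answered C d) := by
  refine Triple.of_wp ?_ hT
  simp [Prog.wp, Instr.Fits, Instr.run, Answered, h]

theorem fullProg_spec (hW : WordBound C d W) (hskew : C.IsSkew) (hd : C.poly.IsHomogeneous d)
    (h0 : ∀ m, 0 ≤ C.poly.coeff m) :
    Triple W fullProg C.input (Nat.fib (2 * d + 1) * C.size * (200 * n + 200)) (Answered C d) := by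
  have hF : 1 ≤ Nat.fib (2 * d + 1) := Nat.fib_pos.2 (by omega)
  have hS : 1 ≤ C.size := C.out.pos
  have hn : n + 3 ≤ W := hW.1
  have hs : C.size + 3 ≤ W := hW.2.1
  generalize hFd : Nat.fib (2 * d + 1) = F at hF
  have hFS : 1 ≤ F * C.size := Nat.mul_pos hF hS
  have hSF : C.size ≤ F * C.size := Nat.le_mul_of_pos_left _ hF
  have hnF : n ≤ F * C.size * n := Nat.le_mul_of_pos_left _ hFS
  have hT : F * C.size * (200 * n + 200) = 200 * (F * C.size * n) + 200 * (F * C.size) := by ring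
  refine Triple.seq (initBlock_spec C (by omega)) (fun s₁ h₁ => ?_)
    (T₂ := F * C.size * (200 * n + 200) - 4) (by omega)
  refine Triple.seq (evalLoop_spec C hn hs h₁) (fun s₂ h₂ => ?_)
    (T₂ := F * C.size * (200 * n + 200) - 5 - 21 * C.size) (by omega)
  refine Triple.seq (degreePrep_spec C hn hs hd h₂) (fun s₃ h₃ => ?_)
    (T₂ := F * C.size * (200 * n + 200) - 10 - 21 * C.size) (by omega)
  have hq : s₃.qreg 20 = MvPolynomial.eval (fun _ => 1) C.poly := by
    simpa using h₃.2.2.2.2.1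
  refine Triple.ite (T₁ := F * C.size * (200 * n + 200) - 11 - 21 * C.size) (fun hc => ?_)
    (fun hc => ?_) (by omega)
  · refine answered_zero ?_ _ (by omega)
    have hz := eq_zero_of_eval_one_eq_zero h0 (hq.symm.trans hc)
    rintro ⟨m, hm, -⟩
    rw [hz] at hm
    simp at hm
  · have hu : MvPolynomial.eval (fun _ => (1 : ℚ)) C.poly ≠ 0 := fun h => hc (hq.trans h)
    refine Triple.seq (degreeLoop_spec C hu hn h₃) (fun s₄ h₄ => ?_)
      (T₂ := F * C.size * (200 * n + 200) - 18 - 21 * C.size - 6 * n) (by omega)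
    obtain ⟨-, -, h13, h6, -⟩ := id h₄
    by_cases hdn : d < n + 1
    · rw [if_pos hdn] at h6
      have hdn' : d ≤ n := by omega
      -- With d ≤ n, all terms of the cost are compared with F · |C| and F · |C| · n, for which the
      -- constant 200 is ample.
      have e1 : F * d ≤ F * C.size * n := by
        rw [mul_assoc]
        exact Nat.mul_le_mul_left _ (hdn'.trans (Nat.le_mul_of_pos_left _ hS))
      have e2 : C.size * n ≤ F * C.size * n := Nat.mul_le_mul_right _ hSF
      have e3 : C.size * d ≤ F * C.size * n := (Nat.mul_le_mul_left _ hdn').trans e2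
      have e4 : F * C.size * d ≤ F * C.size * n := Nat.mul_le_mul_left _ hdn'
      have e5 : 2 * d * (8 * F + 9) + 3 * d + 20 + C.size * (58 * d * F + 15 * F + 12 * d + 3 * n +
          29) = 16 * (F * d) + 21 * d + 20 + (58 * (F * C.size * d) + 15 * (F * C.size) +
          12 * (C.size * d) + 3 * (C.size * n) + 29 * C.size) := by ring
      refine Triple.ite (T₁ := F * C.size * (200 * n + 200) - 19 - 21 * C.size - 6 * n)
        (fun _ => ?_) (fun hc => ?_) (by omega)
      · have := mainProg_spec hW hskew hd h0 hdn h₄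
        rw [hFd] at this
        exact this.mono (by omega) fun _ h => h
      · exact absurd (by simp only [Test.Holds, h6, h13, hdn]) hc
    · rw [if_neg hdn] at h6
      refine Triple.ite (T₁ := F * C.size * (200 * n + 200) - 19 - 21 * C.size - 6 * n)
        (fun hc => ?_) (fun _ => ?_) (by omega)
      · simp [Test.Holds, h6, h13] at hc
      · exact answered_zero (not_hasSquareFreeMonomial_of_lt (by omega)) _ (by omega)

/-- This follows from φ^(j+1) = φ F(j+1) + F(j) ≥ F(j+1) + F(j). -/
theorem fib_succ_le_goldenRatio_pow (k : ℕ) : (Nat.fib (k + 1) : ℝ) ≤ Real.goldenRatio ^ k := by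
  rcases Nat.eq_zero_or_pos k with rfl | hk
  · simp
  · obtain ⟨j, rfl⟩ := Nat.exists_eq_add_of_le' hk
    rw [← Real.goldenRatio_mul_fib_succ_add_fib, Nat.fib_add_two]
    push_cast
    have h1 : (Nat.fib (j + 1) : ℝ) ≤ Real.goldenRatio * Nat.fib (j + 1) :=
      le_mul_of_one_le_left (by positivity) Real.one_lt_goldenRatio.le
    linarith

end RAM

theorem mainTheorem9 :
    ∃ (P : RAM.Prog) (p : Polynomial ℕ) (K : ℕ),
      ∀ (n d : ℕ) (C : ArithCircuit n),
        C.IsSkew → C.poly.IsHomogeneous d → (∀ m : Fin n →₀ ℕ, 0 ≤ C.poly.coeff m) →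
        ∃ (W t : ℕ) (s : RAM.State),
          RAM.Exec W P C.input t s ∧
          (t : ℝ) ≤ Real.goldenRatio ^ (2 * d) * (C.size : ℝ) * ((p.eval n : ℕ) : ℝ) ∧
          (W : ℝ) ≤ (Real.goldenRatio ^ (2 * d) * (C.size : ℝ) * ((p.eval n : ℕ) : ℝ)) ^ K ∧
          (HasSquareFreeMonomial d C.poly → s.wreg 0 = 1) ∧
          (¬ HasSquareFreeMonomial d C.poly → s.wreg 0 = 0) := by
  refine ⟨RAM.fullProg, 200 * Polynomial.X + 200, 2, fun n d C hskew hd h0 => ?_⟩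
  -- The last summand pays for |C| + 1 blocks of 2^(2d) cells each, of which only a small part is
  -- ever touched.
  let W := n + 3 + (C.size + 3) + 8 * (C.size + 1) * 2 ^ (2 * d)
  have hW : RAM.WordBound C d W :=
    ⟨by simp only [W]; omega, by simp only [W]; omega, by simp only [W]; omega⟩
  obtain ⟨t, s, hE, ht, hA⟩ := RAM.fullProg_spec hW hskew hd h0
  have hp : (200 * Polynomial.X + 200 : Polynomial ℕ).eval n = 200 * n + 200 := by simp
  have hS : (1 : ℝ) ≤ C.size := by exact_mod_cast C.out.pos
  refine ⟨W, t, s, hE, ?_, ?_, hA⟩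
  · rw [hp]
    calc (t : ℝ) ≤ ((Nat.fib (2 * d + 1) * C.size * (200 * n + 200) : ℕ) : ℝ) := by exact_mod_cast ht
      _ = (Nat.fib (2 * d + 1) : ℝ) * C.size * ((200 * n + 200 : ℕ) : ℝ) := by push_cast; ring
      _ ≤ _ := by
        gcongr
        exact RAM.fib_succ_le_goldenRatio_pow (2 * d)
  · rw [hp]
    -- The addresses grow like 4^d, which exceeds φ^(2d); since 2 ≤ φ², the square of the time bound
    -- covers them, hence the exponent 2.
    have h2 : (2 : ℝ) ≤ Real.goldenRatio ^ 2 := by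
      rw [Real.goldenRatio_sq]; linarith [Real.one_lt_goldenRatio]
    have h3 : (2 : ℝ) ^ (2 * d) ≤ (Real.goldenRatio ^ (2 * d)) ^ 2 := by
      rw [← pow_mul, mul_comm (2 * d) 2, pow_mul Real.goldenRatio]
      exact pow_le_pow_left₀ (by norm_num) h2 _
    have h4 : (1 : ℝ) ≤ 2 ^ (2 * d) := one_le_pow₀ (by norm_num)
    have hn : (0 : ℝ) ≤ n := Nat.cast_nonneg n
    calc (W : ℝ) = (n + 3 + (C.size + 3)) + 8 * (C.size + 1) * 2 ^ (2 * d) := by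
          simp only [W]; push_cast; ring
      _ ≤ (n + 3 + (C.size + 3)) * 2 ^ (2 * d) + 8 * (C.size + 1) * 2 ^ (2 * d) := by
          gcongr
          exact le_mul_of_one_le_right (by positivity) h4
      _ = 2 ^ (2 * d) * (n + 14 + 9 * C.size) := by ring
      _ ≤ (Real.goldenRatio ^ (2 * d)) ^ 2 * ((C.size : ℝ) ^ 2 * (200 * n + 200) ^ 2) := by
          gcongr
          have h5 : (n : ℝ) + 14 + 9 * C.size ≤ C.size * (200 * n + 200) := by nlinarith
          have h6 : (1 : ℝ) ≤ C.size * (200 * n + 200) := by nlinarith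
          nlinarith
      _ = _ := by push_cast; ring
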